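/- Let $A \in GL_n(\mathbb{R})$ be expansive, i.e. every (complex) eigenvalue $\lambda$ of $A$ satisfies $|\lambda|>1$, let $B=A^T$, and let $\Psi=\{\psi_1,\dots,\psi_L\}\subset L^2(\mathbb{R}^n)$ be a finite family. For a lattice (discrete subgroup) $\Gamma\subset\mathbb{R}^n$ let $$\mathcal{A}(\Psi,A,\Gamma)=\{\,|\det A|^{j/2}\,\psi(A^j\cdot-\gamma) : j\in\mathbb{Z},\ \gamma\in\Gamma,\ \psi\in\Psi\,\},$$ regarded as a family indexed by the triples $(j,\gamma,l)$ with $\psi=\psi_l$. A countable family $\{f_i\}$ in $L^2(\mathbb{R}^n)$ is a Parseval frame if $\sum_i|\langle f,f_i\rangle|^2=\|f\|^2$ for all $f\in L^2(\mathbb{R}^n)$. Let $\Lambda\supseteq\mathbb{Z}^n$ be a lattice in $\mathbb{R}^n$, with dual lattice $\Lambda^*=\{\eta\in\mathbb{R}^n:\langle\eta,\lambda\rangle\in\mathbb{Z}\text{ for all }\lambda\in\Lambda\}$ and determinant $d(\Lambda)=|\det P|$, where $\Lambda=P\mathbb{Z}^n$ with $P\in GL_n(\mathbb{R})$. Suppose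 that $$B^j\mathbb{Z}^n\cap\Lambda^*\subseteq B^j\Lambda^*\qquad\text{for all } j\in\mathbb{Z}.$$ If $\mathcal{A}(\Psi,A,\mathbb{Z}^n)$ is a Parseval frame for $L^2(\mathbb{R}^n)$, then so is $\mathcal{A}(d(\Lambda)^{1/2}\Psi,A,\Lambda)$, where $d(\Lambda)^{1/2}\Psi=\{d(\Lambda)^{1/2}\psi_1,\dots,d(\Lambda)^{1/2}\psi_L\}$. -/

import Mathlib

open MeasureTheory

namespace WaveletOversampling

noncomputable section

/-- The Euclidean space `ℝⁿ`. -/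
abbrev Rn (n : ℕ) : Type := EuclideanSpace ℝ (Fin n)

/-- The complex Hilbert space `L²(ℝⁿ)`, with respect to Lebesgue measure. -/
abbrev L2 (n : ℕ) : Type := Lp ℂ 2 (volume : Measure (Rn n))

/-- A countable family `f` in a Hilbert space is a Parseval frame (a frame with both bounds equal
to `1`) if `∑ᵢ |⟨x, fᵢ⟩|² = ‖x‖²` for every vector `x`. -/
def IsParsevalFrame {ι H : Type*} [NormedAddCommGroup H] [InnerProductSpace ℂ H]
    (f : ι → H) : Prop :=
  Countable ι ∧ ∀ x : H, HasSum (fun i => ‖inner ℂ x (f i)‖ ^ 2) (‖x‖ ^ 2)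

/-- A real square matrix is expansive if all its complex eigenvalues have modulus `> 1`. -/
def IsExpansive {n : ℕ} (A : Matrix (Fin n) (Fin n) ℝ) : Prop :=
  ∀ z ∈ spectrum ℂ (A.map (algebraMap ℝ ℂ)), 1 < ‖z‖

/-- The integer lattice `ℤⁿ` in `ℝⁿ`. -/
def intLattice (n : ℕ) : Submodule ℤ (Rn n) where
  carrier := {x | ∀ i, ∃ m : ℤ, x i = m}
  zero_mem' := fun _ => ⟨0, by simp⟩
  add_mem' := fun {x y} hx hy i => by
    obtain ⟨a, ha⟩ := hx i
    obtain ⟨b, hb⟩ := hy i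
    exact ⟨a + b, by simp [ha, hb]⟩
  smul_mem' := fun c x hx i => by
    obtain ⟨a, ha⟩ := hx i
    exact ⟨c * a, by simp [ha]⟩

/-- The dual lattice `Λ* = {η | ⟨η, x⟩ ∈ ℤ for all x ∈ Λ}`. -/
def dualLattice {n : ℕ} (Λ : Submodule ℤ (Rn n)) : Submodule ℤ (Rn n) where
  carrier := {η | ∀ x ∈ Λ, ∃ m : ℤ, inner ℝ η x = m}
  zero_mem' := fun _ _ => ⟨0, by simp⟩
  add_mem' := fun {η θ} hη hθ x hx => by
    obtain ⟨a, ha⟩ := hη x hx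
    obtain ⟨b, hb⟩ := hθ x hx
    exact ⟨a + b, by rw [inner_add_left, ha, hb]; push_cast; rfl⟩
  smul_mem' := fun c η hη x hx => by
    obtain ⟨a, ha⟩ := hη x hx
    refine ⟨c * a, ?_⟩
    rw [← Int.cast_smul_eq_zsmul ℝ c η, real_inner_smul_left, ha]
    push_cast
    rfl

/-- The image `M S` of a set `S ⊆ ℝⁿ` under the linear map `x ↦ M x`. -/
def matImage {n : ℕ} (M : Matrix (Fin n) (Fin n) ℝ) (S : Set (Rn n)) : Set (Rn n) :=
  (fun x => Matrix.toEuclideanLin M x) '' S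

theorem memLp_dilation {n : ℕ} (A : GL (Fin n) ℝ) (f : L2 n) :
    MemLp (fun x : Rn n => (Real.sqrt |(A : Matrix (Fin n) (Fin n) ℝ).det| : ℂ) *
      f (Matrix.toEuclideanLin (A : Matrix (Fin n) (Fin n) ℝ) x)) 2 volume := by
  have hdet : LinearMap.det (Matrix.toEuclideanLin (A : Matrix (Fin n) (Fin n) ℝ)) ≠ 0 := by
    rw [Matrix.toEuclideanLin, Matrix.toLpLin_eq_toLin, LinearMap.det_toLin]
    exact ((Matrix.isUnit_iff_isUnit_det _).1 A.isUnit).ne_zero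
  have hmeas : Measurable (Matrix.toEuclideanLin (A : Matrix (Fin n) (Fin n) ℝ)) :=
    (LinearMap.continuous_of_finiteDimensional _).measurable
  have h := (Lp.memLp f).smul_measure
    (c := ENNReal.ofReal |(LinearMap.det
      (Matrix.toEuclideanLin (A : Matrix (Fin n) (Fin n) ℝ)))⁻¹|) ENNReal.ofReal_ne_top
  rw [← Measure.map_linearMap_addHaar_eq_smul_addHaar volume hdet] at h
  exact (h.comp_of_map hmeas.aemeasurable).const_mul _

/-- The dilation operator `D_A f (x) = |det A|^{1/2} f (A x)` on `L²(ℝⁿ)`. -/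
def dilation {n : ℕ} (A : GL (Fin n) ℝ) (f : L2 n) : L2 n :=
  (memLp_dilation A f).toLp

/-- The translation operator `T_y f (x) = f (x - y)` on `L²(ℝⁿ)`. -/
def translation {n : ℕ} (y : Rn n) (f : L2 n) : L2 n :=
  Lp.compMeasurePreserving (fun x => x - y) (measurePreserving_sub_right volume y) f

/-- The wavelet system `𝒜(Ψ, A, Γ)` of all `ψ_{j,γ} = D_{A^j} T_γ ψ`, with `j ∈ ℤ`, `γ ∈ Γ` and
`ψ ∈ Ψ = {ψ₁, …, ψ_L}`, as a family indexed by the triples `(j, γ, l)`. -/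
def waveletSystem {n L : ℕ} (Ψ : Fin L → L2 n) (A : GL (Fin n) ℝ) (Γ : Submodule ℤ (Rn n)) :
    ℤ × Γ × Fin L → L2 n :=
  fun p => dilation (A ^ p.1) (translation (p.2.1 : Rn n) (Ψ p.2.2))

end

end WaveletOversampling

open WaveletOversampling

/-!
# Oversampling Parseval wavelet frames

Let `B = Aᵀ` and write `e(t) = exp(2πit)`. On the Fourier side the wavelet `D_{Aʲ} T_γ ψ` becomes
`|det B|^{-j/2} e(-⟨A⁻ʲ γ, ξ⟩) ψ̂(B⁻ʲ ξ)`. Put `h_{j,ψ}(ξ) = conj(f̂(ξ)) ψ̂(B⁻ʲ ξ)`. For a lattice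
`Γ = P ℤⁿ`, Parseval's identity for Fourier series, applied to the periodization of `h_{j,ψ}`, gives
(`hasSum_sq_inner_lattice`)

  `|det P| ∑_{γ ∈ Γ} |⟨f, D_{Aʲ} T_γ ψ⟩|² = ∑_{α ∈ Bʲ Γ*} c_{j,ψ}(α)`,

where `c_{j,ψ}(α) = ∫ h_{j,ψ}(ξ + α) conj(h_{j,ψ}(ξ)) dξ` does not depend on `Γ`. So the normalized
energies for `ℤⁿ` and for `Λ` are sums of the same terms, over `α ∈ Bʲ ℤⁿ` and over `α ∈ Bʲ Λ*`.

It suffices to treat the dense set of those `f` whose Fourier transform is bounded and supported in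
an annulus (`dense_isAnnular`, `hasSum_sq_inner_of_dense`). For these the double series over
`(j, ψ)` and `α` converges absolutely (`summable_indicator_autocorr`). At large scales only `α = 0`
contributes, because `B⁻ʲ → 0` by Gelfand's formula, and the sum over these scales is controlled by
the frame property. At small scales the number of relevant `α` is `O(|det B|⁻ʲ)`, and the factors
`|det B|⁻ʲ ∫ |h_{j,ψ}|²` are at most a constant times the energies of `ψ̂` in boundedly overlapping
sets.

Translating `f` by `x` multiplies `c_{j,ψ}(α)` by a character `e(±⟨x, α⟩)` and leaves the norm
unchanged. Hence, with `C(α) = ∑ c_{j,ψ}(α)` over all `(j, ψ)` with `α ∈ Bʲ ℤⁿ`, the frame property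
for `ℤⁿ` says that the series `∑_α C(α) e(-⟨x, α⟩)` is equal to `‖f‖²` for all `x`. By uniqueness of
absolutely convergent trigonometric series (`eq_zero_of_tsum_fourierChar_eq`), `C(α) = 0` for
`α ≠ 0` and `C(0) = ‖f‖²`.

For `Λ` the scales at which `α` occurs are those with `α ∈ Bʲ Λ*`. By the hypothesis on `Λ`,
rescaled by a power of `B`, these are either none or precisely those with `α ∈ Bʲ ℤⁿ`. So the total over `Λ`
at a frequency `α` is `0` or `C(α)`, with the second case for `α = 0`, and the sum over all `α` is
again `‖f‖²` (`hasSum_oversampled`).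
-/

open WaveletOversampling

namespace WaveletOversampling

open Set Filter Topology
open scoped ENNReal NNReal Real ComplexConjugate FourierTransform

/-! ### Linear maps given by matrices -/

section MatrixAction

variable {n : ℕ}

theorem toEuclideanLin_mul_apply (M N : Matrix (Fin n) (Fin n) ℝ) (x : Rn n) :
    Matrix.toEuclideanLin (M * N) x = Matrix.toEuclideanLin M (Matrix.toEuclideanLin N x) := by
  simp

theorem toEuclideanLin_one_apply (x : Rn n) :
    Matrix.toEuclideanLin (1 : Matrix (Fin n) (Fin n) ℝ) x = x := by
  simp

theorem inner_toEuclideanLin_left (M : Matrix (Fin n) (Fin n) ℝ) (x y : Rn n) :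
    inner ℝ (Matrix.toEuclideanLin M x) y = inner ℝ x (Matrix.toEuclideanLin M.transpose y) := by
  simp only [Matrix.toLpLin_apply, EuclideanSpace.inner_eq_star_dotProduct, star_trivial]
  rw [Matrix.dotProduct_mulVec, Matrix.mulVec_transpose]

theorem det_toEuclideanLin (M : Matrix (Fin n) (Fin n) ℝ) :
    LinearMap.det (Matrix.toEuclideanLin M) = M.det := by
  rw [Matrix.toEuclideanLin, Matrix.toLpLin_eq_toLin, LinearMap.det_toLin]

theorem measurable_toEuclideanLin (M : Matrix (Fin n) (Fin n) ℝ) :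
    Measurable (Matrix.toEuclideanLin M) :=
  (LinearMap.continuous_of_finiteDimensional _).measurable

theorem injective_toEuclideanLin {M : Matrix (Fin n) (Fin n) ℝ} (hM : M.det ≠ 0) :
    Function.Injective (Matrix.toEuclideanLin M) := by
  refine Function.LeftInverse.injective (g := Matrix.toEuclideanLin M⁻¹) fun x => ?_
  rw [← toEuclideanLin_mul_apply, Matrix.nonsing_inv_mul _ hM.isUnit, toEuclideanLin_one_apply]

theorem measurableEmbedding_toEuclideanLin {M : Matrix (Fin n) (Fin n) ℝ} (hM : M.det ≠ 0) :
    MeasurableEmbedding (Matrix.toEuclideanLin M) :=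
  (LinearMap.continuous_of_finiteDimensional _).measurableEmbedding (injective_toEuclideanLin hM)

theorem map_toEuclideanLin_volume {M : Matrix (Fin n) (Fin n) ℝ} (hM : M.det ≠ 0) :
    Measure.map (Matrix.toEuclideanLin M) volume =
      ENNReal.ofReal |M.det|⁻¹ • (volume : Measure (Rn n)) := by
  rw [Measure.map_linearMap_addHaar_eq_smul_addHaar volume (by rwa [det_toEuclideanLin]),
    det_toEuclideanLin, abs_inv]

theorem quasiMeasurePreserving_toEuclideanLin {M : Matrix (Fin n) (Fin n) ℝ} (hM : M.det ≠ 0) :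
    Measure.QuasiMeasurePreserving (Matrix.toEuclideanLin M) (volume : Measure (Rn n)) volume :=
  ⟨measurable_toEuclideanLin M, by
    rw [map_toEuclideanLin_volume hM]; exact Measure.smul_absolutelyContinuous⟩

theorem integral_comp_toEuclideanLin {E : Type*} [NormedAddCommGroup E] [NormedSpace ℝ E]
    {M : Matrix (Fin n) (Fin n) ℝ} (hM : M.det ≠ 0) (f : Rn n → E) :
    ∫ x, f (Matrix.toEuclideanLin M x) = |M.det|⁻¹ • ∫ x, f x := by
  rw [← (measurableEmbedding_toEuclideanLin hM).integral_map, map_toEuclideanLin_volume hM,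
    integral_smul_measure, ENNReal.toReal_ofReal (by positivity)]

theorem lintegral_comp_toEuclideanLin {M : Matrix (Fin n) (Fin n) ℝ} (hM : M.det ≠ 0)
    (f : Rn n → ℝ≥0∞) :
    ∫⁻ x, f (Matrix.toEuclideanLin M x) = ENNReal.ofReal |M.det|⁻¹ * ∫⁻ x, f x := by
  rw [← (measurableEmbedding_toEuclideanLin hM).lintegral_map, map_toEuclideanLin_volume hM,
    lintegral_smul_measure, smul_eq_mul]

theorem memLp_comp_toEuclideanLin {E : Type*} [NormedAddCommGroup E]
    {M : Matrix (Fin n) (Fin n) ℝ} (hM : M.det ≠ 0) {f : Rn n → E} {p : ℝ≥0∞}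
    (hf : MemLp f p volume) :
    MemLp (fun x => f (Matrix.toEuclideanLin M x)) p volume := by
  refine MemLp.comp_of_map ?_ (measurable_toEuclideanLin M).aemeasurable
  rw [map_toEuclideanLin_volume hM]
  exact hf.smul_measure ENNReal.ofReal_ne_top

end MatrixAction

/-! ### Periodization and Fourier series on the torus -/

section Periodization

variable {n : ℕ}

/-- The integer vector `k`, as an element of `Fin n → ℝ`. -/
def castVec (k : Fin n → ℤ) : Fin n → ℝ := fun i => k i

theorem castVec_add (k m : Fin n → ℤ) : castVec (k + m) = castVec k + castVec m := by
  ext; simp [castVec]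

/-- The half-open unit cube `∏ (kᵢ, kᵢ + 1]` with integer corner `k`. -/
def unitCube (k : Fin n → ℤ) : Set (Fin n → ℝ) := {x | ∀ i, x i ∈ Ioc (k i : ℝ) (k i + 1)}

theorem measurableSet_unitCube (k : Fin n → ℤ) : MeasurableSet (unitCube k) :=
  MeasurableSet.univ_pi' (fun _ => measurableSet_Ioc)

theorem mem_unitCube_iff {k : Fin n → ℤ} {x : Fin n → ℝ} :
    x ∈ unitCube k ↔ k = fun i => ⌈x i⌉ - 1 := by
  simp only [unitCube, mem_ofPred_eq, funext_iff, mem_Ioc]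
  refine forall_congr' fun i => ?_
  rw [eq_sub_iff_add_eq, eq_comm, Int.ceil_eq_iff]
  push_cast
  constructor <;> rintro ⟨h1, h2⟩ <;> constructor <;> linarith

theorem pairwise_disjoint_unitCube : Pairwise (Function.onFun Disjoint (unitCube (n := n))) := by
  intro k m hkm
  refine Set.disjoint_left.2 fun x hk hm => hkm ?_
  rw [mem_unitCube_iff.1 hk, mem_unitCube_iff.1 hm]

theorem add_castVec_mem_unitCube {k : Fin n → ℤ} {x : Fin n → ℝ} :
    x + castVec k ∈ unitCube k ↔ x ∈ unitCube (0 : Fin n → ℤ) := by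
  simp only [unitCube, mem_ofPred_eq, castVec, Pi.add_apply, mem_Ioc, Pi.zero_apply]
  refine forall_congr' fun i => ?_
  push_cast
  constructor <;> rintro ⟨h1, h2⟩ <;> constructor <;> linarith

theorem setIntegral_unitCube {E : Type*} [NormedAddCommGroup E] [NormedSpace ℝ E]
    (g : (Fin n → ℝ) → E) (k : Fin n → ℤ) :
    ∫ x in unitCube k, g x = ∫ x in unitCube 0, g (x + castVec k) := by
  rw [← (measurePreserving_add_right volume (castVec k)).setIntegral_preimage_emb
    (measurableEmbedding_addRight _)]
  congr 2
  ext x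
  exact add_castVec_mem_unitCube

theorem exists_finset_support_subset_unitCube {E : Type*} [Zero E] {g : (Fin n → ℝ) → E} {R : ℝ}
    (hg : ∀ x, R < ‖x‖ → g x = 0) :
    ∃ S : Finset (Fin n → ℤ), ∀ k ∉ S, ∀ x ∈ unitCube k, g x = 0 := by
  refine ⟨Fintype.piFinset fun _ => Finset.Icc (-(⌈R⌉ + 1)) (⌈R⌉ + 1), fun k hk x hx => hg x ?_⟩
  by_contra! hR
  refine hk (Fintype.mem_piFinset.2 fun i => ?_)
  have h1 := (norm_le_pi_norm x i).trans hR
  rw [Real.norm_eq_abs, abs_le] at h1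
  have h2 := hx i
  have h3 := Int.le_ceil R
  rw [Finset.mem_Icc]
  constructor
  · have : (-(⌈R⌉ + 1) : ℝ) ≤ k i := by linarith [h2.2]
    exact_mod_cast this
  · have : (k i : ℝ) ≤ ⌈R⌉ + 1 := by linarith [h2.1]
    exact_mod_cast this

theorem integral_eq_sum_unitCube {E : Type*} [NormedAddCommGroup E] [NormedSpace ℝ E]
    {g : (Fin n → ℝ) → E} (hgi : Integrable g) {S : Finset (Fin n → ℤ)}
    (hg : ∀ k ∉ S, ∀ x ∈ unitCube k, g x = 0) :
    ∫ x, g x = ∑ k ∈ S, ∫ x in unitCube 0, g (x + castVec k) := by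
  simp_rw [← setIntegral_unitCube]
  rw [← integral_biUnion_finset S (fun k _ => measurableSet_unitCube k)
    (fun _ _ _ _ h => pairwise_disjoint_unitCube h) (fun _ _ => hgi.integrableOn)]
  symm
  apply setIntegral_eq_integral_of_forall_compl_eq_zero
  intro x hx
  have hx' : x ∈ unitCube (fun i => ⌈x i⌉ - 1) := mem_unitCube_iff.2 rfl
  refine hg _ (fun h => hx ?_) x hx'
  exact mem_biUnion h hx'

/-- The autocorrelation `a ↦ ∫ h(x + a) conj(h(x)) dx` of a complex function `h`. -/
noncomputable def autocorr {V : Type*} [Add V] [MeasureSpace V] (h : V → ℂ) (a : V) : ℂ :=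
  ∫ x, h (x + a) * conj (h x)

-- As in Mathlib's file on multivariate Fourier series, the circle carries the normalized
-- Haar measure.
noncomputable local instance : MeasureSpace UnitAddCircle := ⟨AddCircle.haarAddCircle⟩

local instance : Measure.IsAddHaarMeasure (volume : Measure UnitAddCircle) :=
  inferInstanceAs (Measure.IsAddHaarMeasure AddCircle.haarAddCircle)

local instance : IsProbabilityMeasure (volume : Measure UnitAddCircle) :=
  inferInstanceAs (IsProbabilityMeasure AddCircle.haarAddCircle)

/-- Parseval's identity for multiple Fourier series, transferred from the torus to the unit cube. -/
theorem hasSum_sq_setIntegral_mFourier {f : (Fin n → ℝ) → ℂ}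
    (hf : MemLp f 2 (volume.restrict (unitCube 0))) :
    HasSum (fun k : Fin n → ℤ => ‖∫ x in unitCube 0,
        UnitAddTorus.mFourier (-k) (fun i => (x i : UnitAddCircle)) * f x‖ ^ 2)
      (∫ x in unitCube 0, ‖f x‖ ^ 2) := by
  let a : Fin n → ℝ := castVec 0
  let rep : UnitAddTorus (Fin n) → (Fin n → ℝ) := fun t =>
    (UnitAddTorus.measurableEquivPiIoc a t).1
  have hrep : MeasurePreserving rep volume (volume.restrict (unitCube 0)) := by
    refine MeasurePreserving.comp (μb := Measure.comap Subtype.val volume)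
      ⟨measurable_subtype_coe, ?_⟩
      (UnitAddTorus.measurePreserving_equivPiIoc a)
    exact map_comap_subtype_coe (measurableSet_unitCube 0) volume
  have hrep_coe : ∀ x ∈ unitCube (0 : Fin n → ℤ), rep (fun i => (x i : UnitAddCircle)) = x := by
    intro x hx
    ext i
    simp only [rep, UnitAddTorus.coe_measurableEquivPiIoc_apply]
    exact AddCircle.equivIoc_coe_of_mem (p := (1 : ℝ)) (a := a i) (y := x i) (hx i)
  have hF : MemLp (f ∘ rep) 2 volume := hf.comp_measurePreserving hrep
  have key := UnitAddTorus.hasSum_sq_mFourierCoeff (hF.toLp _)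
  have h1 : ∫ t, ‖hF.toLp _ t‖ ^ 2 = ∫ x in unitCube 0, ‖f x‖ ^ 2 := by
    rw [integral_congr_ae (g := fun t => ‖(f ∘ rep) t‖ ^ 2)
      (hF.coeFn_toLp.mono fun t ht => by simp only [ht]), UnitAddTorus.integral_preimage _ a]
    refine setIntegral_congr_fun (measurableSet_unitCube 0) fun x hx => ?_
    simp only [Function.comp, hrep_coe x hx]
  rw [h1] at key
  refine key.congr_fun fun k => ?_
  congr 2
  have h2 : UnitAddTorus.mFourierCoeff (hF.toLp _) k = UnitAddTorus.mFourierCoeff (f ∘ rep) k :=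
    integral_congr_ae (hF.coeFn_toLp.mono fun t ht => by simp only [ht])
  rw [h2, UnitAddTorus.mFourierCoeff_eq_integral _ _ a]
  refine setIntegral_congr_fun (measurableSet_unitCube 0) fun x hx => ?_
  simp only [Function.comp, hrep_coe x hx, smul_eq_mul]

theorem coe_add_castVec (x : Fin n → ℝ) (m : Fin n → ℤ) :
    (fun i => ((x + castVec m) i : UnitAddCircle)) = fun i => (x i : UnitAddCircle) := by
  ext i
  simp [castVec]

theorem continuous_mFourier_coe (k : Fin n → ℤ) :
    Continuous fun x : Fin n → ℝ => UnitAddTorus.mFourier (-k) (fun i => (x i : UnitAddCircle)) :=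
  (UnitAddTorus.mFourier (-k)).continuous.comp
    (continuous_pi fun i => (AddCircle.continuous_mk' 1).comp (continuous_apply i))

theorem norm_mFourier_le (k : Fin n → ℤ) (x : Fin n → ℝ) :
    ‖UnitAddTorus.mFourier (-k) (fun i => (x i : UnitAddCircle))‖ ≤ 1 :=
  (ContinuousMap.norm_coe_le_norm _ _).trans UnitAddTorus.mFourier_norm.le

/-- For `h` in `L²` of bounded support, the squared values of the Fourier integral of `h` at the
integer vectors and the autocorrelations of `h` at the integer vectors have the same sum: both are
equal to the squared norm, over the unit cube, of the periodization `P` of `h`. -/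
theorem hasSum_sq_integral_mFourier {h : (Fin n → ℝ) → ℂ} (hh : MemLp h 2 volume) {R : ℝ}
    (hR : ∀ x, R < ‖x‖ → h x = 0) :
    ∃ W : ℝ, HasSum (fun k : Fin n → ℤ => ‖∫ x,
          UnitAddTorus.mFourier (-k) (fun i => (x i : UnitAddCircle)) * h x‖ ^ 2) W ∧
      HasSum (fun k : Fin n → ℤ => autocorr h (castVec k)) (W : ℂ) := by
  obtain ⟨S, hS⟩ := exists_finset_support_subset_unitCube hR
  have hS' : ∀ k ∉ S, ∀ x ∈ unitCube (0 : Fin n → ℤ), h (x + castVec k) = 0 := fun k hk x hx =>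
    hS k hk _ (add_castVec_mem_unitCube.2 hx)
  have htr : ∀ a : Fin n → ℝ, MemLp (fun x => h (x + a)) 2 volume := fun a =>
    hh.comp_measurePreserving (measurePreserving_add_right volume a)
  have hprod : ∀ a b : Fin n → ℝ, Integrable fun x => h (x + a) * conj (h (x + b)) := fun a b =>
    (htr a).integrable_mul (htr b).star
  have hint : Integrable h := by
    have hsub : Function.support h ⊆ Metric.closedBall 0 R := fun x hx => by
      by_contra hx'
      exact hx (hR x (by simpa using hx'))
    refine (integrableOn_iff_integrable_of_support_subset hsub).1 ?_
    have : IsFiniteMeasure ((volume : Measure (Fin n → ℝ)).restrict (Metric.closedBall 0 R)) :=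
      ⟨by simpa using measure_closedBall_lt_top (x := (0 : Fin n → ℝ))⟩
    exact hh.restrict _ |>.integrable (by norm_num)
  let P : (Fin n → ℝ) → ℂ := fun x => ∑ m ∈ S, h (x + castVec m)
  have hP : MemLp P 2 (volume.restrict (unitCube 0)) :=
    memLp_finsetSum S fun m _ => (htr _).restrict _
  refine ⟨∫ x in unitCube 0, ‖P x‖ ^ 2, ?_, ?_⟩
  · refine (hasSum_sq_setIntegral_mFourier hP).congr_fun fun k => ?_
    congr 2
    rw [integral_eq_sum_unitCube (S := S)]
    · simp only [P, Finset.mul_sum]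
      rw [integral_finsetSum]
      · refine Finset.sum_congr rfl fun m _ => integral_congr_ae (.of_forall fun x => ?_)
        simp only [coe_add_castVec]
      · intro m _
        exact (hint.comp_add_right (castVec m)).integrableOn.bdd_mul
          (continuous_mFourier_coe k).aestronglyMeasurable (.of_forall (norm_mFourier_le k))
    · exact hint.bdd_mul (continuous_mFourier_coe k).aestronglyMeasurable
        (.of_forall (norm_mFourier_le k))
    · intro m hm x hx
      rw [hS m hm x hx, mul_zero]
  · have e1 : ((∫ x in unitCube 0, ‖P x‖ ^ 2 : ℝ) : ℂ) =
        ∑ m' ∈ S, ∑ m ∈ S,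
          ∫ x in unitCube 0, h (x + castVec m) * conj (h (x + castVec m')) := by
      rw [← integral_complex_ofReal]
      have : ∀ x, ((‖P x‖ ^ 2 : ℝ) : ℂ) =
          ∑ m' ∈ S, ∑ m ∈ S, h (x + castVec m) * conj (h (x + castVec m')) := fun x => by
        rw [Complex.ofReal_pow, ← Complex.mul_conj', map_sum, Finset.sum_mul_sum,
          Finset.sum_comm]
      simp_rw [this]
      rw [integral_finsetSum _ fun m' _ => integrable_finsetSum _ fun m _ =>
        (hprod _ _).integrableOn]
      exact Finset.sum_congr rfl fun m' _ =>
        integral_finsetSum _ fun m _ => (hprod _ _).integrableOn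
    have e2 : ∀ k : Fin n → ℤ, autocorr h (castVec k) = ∑ m' ∈ S, 
          ∫ x in unitCube 0, h (x + castVec (m' + k)) * conj (h (x + castVec m')) := by
      intro k
      rw [autocorr, integral_eq_sum_unitCube (S := S)]
      · simp only [castVec_add, add_assoc]
      · simpa using hprod (castVec k) 0
      · intro m hm x hx
        rw [hS m hm x hx, map_zero, mul_zero]
    rw [e1]
    simp_rw [e2]
    refine hasSum_sum fun m' _ => ?_
    refine (Equiv.addLeft m').hasSum_iff (f := fun m => 
      ∫ x in unitCube 0, h (x + castVec m) * conj (h (x + castVec m'))) |>.2 ?_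
    refine hasSum_sum_of_ne_finset_zero fun m hm => ?_
    refine setIntegral_eq_zero_of_forall_eq_zero fun x hx => ?_
    rw [hS' m hm x hx, zero_mul]

end Periodization

/-! ### The Parseval identity for a lattice -/

section LatticeParseval

variable {n : ℕ}

/-- The integer vector `k`, as a point of the Euclidean space `ℝⁿ`. -/
noncomputable def intVec (k : Fin n → ℤ) : Rn n := WithLp.toLp 2 (castVec k)

theorem mFourier_eq_fourierChar (k : Fin n → ℤ) (x : Fin n → ℝ) :
    UnitAddTorus.mFourier (-k) (fun i => (x i : UnitAddCircle)) =
      (𝐞 (-(inner ℝ (intVec k) (WithLp.toLp 2 x))) : ℂ) := by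
  simp only [UnitAddTorus.mFourier, ContinuousMap.coe_mk, fourier_coe_apply, intVec, castVec,
    Real.fourierChar_apply, ← Complex.exp_sum, EuclideanSpace.inner_eq_star_dotProduct,
    dotProduct, star_trivial]
  congr 1
  push_cast
  rw [← Finset.sum_neg_distrib, Finset.mul_sum, Finset.sum_mul]
  refine Finset.sum_congr rfl fun i _ => ?_
  simp
  ring

/-- Reformulation of `hasSum_sq_integral_mFourier` on Euclidean space. -/
theorem hasSum_sq_integral_intVec {h : Rn n → ℂ} (hh : MemLp h 2 volume) {R : ℝ}
    (hR : ∀ x, R < ‖x‖ → h x = 0) :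
    ∃ W : ℝ, HasSum (fun k : Fin n → ℤ =>
        ‖∫ x, (𝐞 (-(inner ℝ (intVec k) x)) : ℂ) * h x‖ ^ 2) W ∧
      HasSum (fun k : Fin n → ℤ => autocorr h (intVec k)) (W : ℂ) := by
  have hmp := PiLp.volume_preserving_toLp (Fin n)
  have hemb := (MeasurableEquiv.toLp 2 (Fin n → ℝ)).measurableEmbedding
  obtain ⟨W, h1, h2⟩ := hasSum_sq_integral_mFourier (h := fun x => h (WithLp.toLp 2 x))
    (hh.comp_measurePreserving hmp) (R := R) fun x hx => hR _ (hx.trans_le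
      ((pi_norm_le_iff_of_nonneg (norm_nonneg _)).2 fun i =>
        PiLp.norm_apply_le (WithLp.toLp 2 x : Rn n) i))
  refine ⟨W, h1.congr_fun fun k => ?_, h2.congr_fun fun k => ?_⟩
  · rw [← hmp.integral_comp hemb]
    simp only [mFourier_eq_fourierChar]
  · rw [autocorr, ← hmp.integral_comp hemb]
    rfl

/-- The two sums over the lattice `M ℤⁿ` and over its dual lattice, obtained from the case `M = 1`
by a linear change of variables. -/
theorem hasSum_sq_integral_lattice {M : Matrix (Fin n) (Fin n) ℝ} (hM : M.det ≠ 0)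
    {h : Rn n → ℂ} (hh : MemLp h 2 volume) {R : ℝ} (hR : ∀ x, R < ‖x‖ → h x = 0) :
    ∃ W : ℝ, HasSum (fun k : Fin n → ℤ =>
        ‖∫ x, (𝐞 (-(inner ℝ (Matrix.toEuclideanLin M (intVec k)) x)) : ℂ) * h x‖ ^ 2)
          (|M.det|⁻¹ * W) ∧
      HasSum (fun k : Fin n → ℤ =>
        autocorr h (Matrix.toEuclideanLin M.transpose⁻¹ (intVec k))) (W : ℂ) := by
  have hMt : (M.transpose⁻¹).det ≠ 0 := by
    simpa [Matrix.det_nonsing_inv] using hM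
  have hdet : |(M.transpose⁻¹).det|⁻¹ = |M.det| := by
    rw [Matrix.det_nonsing_inv, Ring.inverse_eq_inv', abs_inv, inv_inv, Matrix.det_transpose]
  have hcancel : ∀ x : Rn n, Matrix.toEuclideanLin M.transpose
      (Matrix.toEuclideanLin M.transpose⁻¹ x) = x := by
    intro x
    rw [← toEuclideanLin_mul_apply, Matrix.mul_nonsing_inv _ (by simpa using hM.isUnit),
      toEuclideanLin_one_apply]
  let C : ℝ := ‖(Matrix.toEuclideanLin M.transpose).toContinuousLinearMap‖
  obtain ⟨W, h1, h2⟩ := hasSum_sq_integral_intVec (memLp_comp_toEuclideanLin hMt hh)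
    (R := C * R) fun x hx => hR _ (by
      by_contra! hle
      have := (Matrix.toEuclideanLin M.transpose).toContinuousLinearMap.le_opNorm
        (Matrix.toEuclideanLin M.transpose⁻¹ x)
      rw [LinearMap.coe_toContinuousLinearMap', hcancel] at this
      exact absurd (this.trans (mul_le_mul_of_nonneg_left hle (norm_nonneg _))) (not_le.2 hx))
  have hMpos : 0 < |M.det| := abs_pos.2 hM
  refine ⟨|M.det|⁻¹ * W, ?_, ?_⟩
  · have := h1.mul_left (|M.det|⁻¹ * |M.det|⁻¹)
    rw [mul_assoc] at this
    refine this.congr_fun fun k => ?_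
    have e := integral_comp_toEuclideanLin hMt (fun x =>
      (𝐞 (-(inner ℝ (Matrix.toEuclideanLin M (intVec k)) x)) : ℂ) * h x)
    simp only [inner_toEuclideanLin_left, hcancel] at e ⊢
    rw [e, hdet, norm_smul, mul_pow, Real.norm_eq_abs, abs_abs]
    field_simp
  · have := h2.mul_left ((|M.det|⁻¹ : ℝ) : ℂ)
    rw [← Complex.ofReal_mul] at this
    refine this.congr_fun fun k => ?_
    have e := integral_comp_toEuclideanLin hMt (fun x =>
      h (x + Matrix.toEuclideanLin M.transpose⁻¹ (intVec k)) * conj (h x))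
    simp only [autocorr, map_add] at e ⊢
    rw [e, hdet]
    simp [hMpos.ne']

end LatticeParseval

/-! ### Dilations and translations under the Fourier transform -/

section Operators

variable {n : ℕ}

theorem det_coe_ne_zero (A : GL (Fin n) ℝ) : (A : Matrix (Fin n) (Fin n) ℝ).det ≠ 0 :=
  ((Matrix.isUnit_iff_isUnit_det _).1 A.isUnit).ne_zero

theorem norm_sq_eq_integral (f : L2 n) : ‖f‖ ^ 2 = ∫ x, ‖f x‖ ^ 2 := by
  have h := L2.inner_def (𝕜 := ℂ) f f
  rw [inner_self_eq_norm_sq_to_K] at h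
  simp only [inner_self_eq_norm_sq_to_K] at h
  have h' : ((‖f‖ ^ 2 : ℝ) : ℂ) = ((∫ x, ‖f x‖ ^ 2 : ℝ) : ℂ) := by
    rw [← integral_complex_ofReal]
    simpa using h
  exact_mod_cast h'

theorem coeFn_dilation (A : GL (Fin n) ℝ) (f : L2 n) :
    dilation A f =ᵐ[volume] fun x => (Real.sqrt |(A : Matrix (Fin n) (Fin n) ℝ).det| : ℂ) *
      f (Matrix.toEuclideanLin (A : Matrix (Fin n) (Fin n) ℝ) x) :=
  (memLp_dilation A f).coeFn_toLp

theorem coeFn_translation (y : Rn n) (f : L2 n) :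
    translation y f =ᵐ[volume] fun x => f (x - y) :=
  Lp.coeFn_compMeasurePreserving f (measurePreserving_sub_right volume y)

theorem ae_comp_toEuclideanLin {M : Matrix (Fin n) (Fin n) ℝ} (hM : M.det ≠ 0) {f g : Rn n → ℂ}
    (h : f =ᵐ[volume] g) :
    (fun x => f (Matrix.toEuclideanLin M x)) =ᵐ[volume]
      fun x => g (Matrix.toEuclideanLin M x) :=
  (quasiMeasurePreserving_toEuclideanLin hM).ae_eq_comp h

theorem dilation_smul (A : GL (Fin n) ℝ) (c : ℂ) (f : L2 n) :
    dilation A (c • f) = c • dilation A f := by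
  apply Lp.ext
  filter_upwards [coeFn_dilation A (c • f), coeFn_dilation A f, Lp.coeFn_smul c (dilation A f),
    ae_comp_toEuclideanLin (det_coe_ne_zero A) (Lp.coeFn_smul c f)] with x h1 h2 h3 h4
  rw [h1, h3, Pi.smul_apply, h2, h4, Pi.smul_apply, smul_eq_mul, smul_eq_mul, mul_left_comm]

theorem dilation_sub (A : GL (Fin n) ℝ) (f g : L2 n) :
    dilation A (f - g) = dilation A f - dilation A g := by
  apply Lp.ext
  filter_upwards [coeFn_dilation A (f - g), coeFn_dilation A f, coeFn_dilation A g,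
    Lp.coeFn_sub (dilation A f) (dilation A g),
    ae_comp_toEuclideanLin (det_coe_ne_zero A) (Lp.coeFn_sub f g)] with x h1 h2 h3 h4 h5
  rw [h1, h4, Pi.sub_apply, h2, h3, h5, Pi.sub_apply, mul_sub]

theorem norm_dilation (A : GL (Fin n) ℝ) (f : L2 n) : ‖dilation A f‖ = ‖f‖ := by
  refine (sq_eq_sq₀ (norm_nonneg _) (norm_nonneg _)).1 ?_
  rw [norm_sq_eq_integral, norm_sq_eq_integral]
  have h1 : ∫ x, ‖dilation A f x‖ ^ 2 = ∫ x, |(A : Matrix (Fin n) (Fin n) ℝ).det| *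
      ‖f (Matrix.toEuclideanLin (A : Matrix (Fin n) (Fin n) ℝ) x)‖ ^ 2 := by
    refine integral_congr_ae ((coeFn_dilation A f).mono fun x hx => ?_)
    simp only [hx, norm_mul, mul_pow, Complex.norm_real, Real.norm_eq_abs, sq_abs,
      Real.sq_sqrt (abs_nonneg _)]
  rw [h1, integral_const_mul, integral_comp_toEuclideanLin (det_coe_ne_zero A)
    (fun x => ‖f x‖ ^ 2), smul_eq_mul, mul_inv_cancel_left₀ (abs_pos.2 (det_coe_ne_zero A)).ne']

theorem continuous_dilation (A : GL (Fin n) ℝ) : Continuous (dilation (n := n) A) :=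
  (Isometry.of_dist_eq fun f g => by
    rw [dist_eq_norm, dist_eq_norm, ← dilation_sub, norm_dilation]).continuous

theorem continuous_translation (y : Rn n) : Continuous (translation (n := n) y) :=
  (Lp.isometry_compMeasurePreserving (measurePreserving_sub_right volume y)).continuous

theorem translation_smul (y : Rn n) (c : ℂ) (f : L2 n) :
    translation y (c • f) = c • translation y f :=
  (Lp.compMeasurePreservingₗ ℂ _ (measurePreserving_sub_right volume y)).map_smul c f

/-- Composition of a Schwartz function with an invertible matrix. -/
noncomputable def schwartzComp (A : GL (Fin n) ℝ) (s : SchwartzMap (Rn n) ℂ) :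
    SchwartzMap (Rn n) ℂ :=
  SchwartzMap.compCLMOfContinuousLinearEquiv ℂ (LinearMap.equivOfDetNeZero
    (Matrix.toEuclideanLin (A : Matrix (Fin n) (Fin n) ℝ))
    (by rw [det_toEuclideanLin]; exact det_coe_ne_zero A)).toContinuousLinearEquiv s

theorem schwartzComp_apply (A : GL (Fin n) ℝ) (s : SchwartzMap (Rn n) ℂ) (x : Rn n) :
    schwartzComp A s x = s (Matrix.toEuclideanLin (A : Matrix (Fin n) (Fin n) ℝ) x) := rfl

theorem dilation_toLp (A : GL (Fin n) ℝ) (s : SchwartzMap (Rn n) ℂ) :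
    dilation A (s.toLp 2) =
      (Real.sqrt |(A : Matrix (Fin n) (Fin n) ℝ).det| : ℂ) • (schwartzComp A s).toLp 2 volume := by
  apply Lp.ext
  filter_upwards [coeFn_dilation A (s.toLp 2),
    Lp.coeFn_smul (Real.sqrt |(A : Matrix (Fin n) (Fin n) ℝ).det| : ℂ)
      ((schwartzComp A s).toLp 2 volume),
    (schwartzComp A s).coeFn_toLp 2,
    ae_comp_toEuclideanLin (det_coe_ne_zero A) (s.coeFn_toLp 2)] with x h1 h2 h3 h4
  rw [h1, h2, Pi.smul_apply, h3, h4, smul_eq_mul, schwartzComp_apply]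

theorem fourier_schwartzComp {A A' : GL (Fin n) ℝ}
    (hA : (A' : Matrix (Fin n) (Fin n) ℝ) = (A : Matrix (Fin n) (Fin n) ℝ).transpose⁻¹)
    (s : SchwartzMap (Rn n) ℂ) (ξ : Rn n) :
    (𝓕 (schwartzComp A s)) ξ = (|(A : Matrix (Fin n) (Fin n) ℝ).det|⁻¹ : ℝ) •
      (𝓕 s) (Matrix.toEuclideanLin (A' : Matrix (Fin n) (Fin n) ℝ) ξ) := by
  have hdet := det_coe_ne_zero A
  have hcancel : Matrix.toEuclideanLin (A : Matrix (Fin n) (Fin n) ℝ).transpose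
      (Matrix.toEuclideanLin (A' : Matrix (Fin n) (Fin n) ℝ) ξ) = ξ := by
    rw [← toEuclideanLin_mul_apply, hA, Matrix.mul_nonsing_inv _ (by simpa using hdet.isUnit),
      toEuclideanLin_one_apply]
  rw [SchwartzMap.fourier_coe, SchwartzMap.fourier_coe, Real.fourier_eq, Real.fourier_eq,
    ← integral_comp_toEuclideanLin hdet]
  simp only [inner_toEuclideanLin_left, hcancel, schwartzComp_apply]

/-- On the Fourier side, dilation by `A` becomes dilation by the inverse transpose of `A`. -/
theorem fourier_dilation {A A' : GL (Fin n) ℝ}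
    (hA : (A' : Matrix (Fin n) (Fin n) ℝ) = (A : Matrix (Fin n) (Fin n) ℝ).transpose⁻¹)
    (f : L2 n) : 𝓕 (dilation A f) = dilation A' (𝓕 f) := by
  have hdet := det_coe_ne_zero A
  have hdet' : (A' : Matrix (Fin n) (Fin n) ℝ).det = (A : Matrix (Fin n) (Fin n) ℝ).det⁻¹ := by
    rw [hA, Matrix.det_nonsing_inv, Ring.inverse_eq_inv', Matrix.det_transpose]
  have hc : (Real.sqrt |(A : Matrix (Fin n) (Fin n) ℝ).det| : ℂ) *
      ((|(A : Matrix (Fin n) (Fin n) ℝ).det|⁻¹ : ℝ) : ℂ) =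
      (Real.sqrt |(A' : Matrix (Fin n) (Fin n) ℝ).det| : ℂ) := by
    have h := abs_pos.2 hdet
    rw [hdet', abs_inv, Real.sqrt_inv, ← Complex.ofReal_mul, Complex.ofReal_inj]
    field_simp
    exact Real.sq_sqrt h.le
  refine DenseRange.induction_on
    (p := fun f : L2 n => 𝓕 (dilation A f) = dilation A' (𝓕 f))
    (SchwartzMap.denseRange_toLpCLM (F := ℂ) (E := Rn n) (p := 2) (μ := volume)
      ENNReal.ofNat_ne_top) f
    (isClosed_eq (ContinuousFourier.continuous_fourier.comp (continuous_dilation A))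
      ((continuous_dilation A').comp ContinuousFourier.continuous_fourier)) fun s => ?_
  change 𝓕 (dilation A (s.toLp 2)) = dilation A' (𝓕 (s.toLp 2))
  rw [dilation_toLp, FourierSMul.fourier_smul, SchwartzMap.toLp_fourier_eq,
    SchwartzMap.toLp_fourier_eq, dilation_toLp]
  have h : 𝓕 (schwartzComp A s) = ((|(A : Matrix (Fin n) (Fin n) ℝ).det|⁻¹ : ℝ) : ℂ) •
      schwartzComp A' (𝓕 s) := by
    ext ξ
    rw [fourier_schwartzComp hA, _root_.smul_apply, schwartzComp_apply, Complex.real_smul,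
      smul_eq_mul]
  rw [← hc, mul_smul, h]
  congr 1

/-- On the Fourier side, translation by `y` becomes multiplication by `ξ ↦ e(-⟨y, ξ⟩)`. -/
theorem coeFn_fourier_translation (y : Rn n) (f : L2 n) :
    (𝓕 (translation y f) : L2 n) =ᵐ[volume] fun ξ => (𝐞 (-inner ℝ y ξ) : ℂ) * (𝓕 f : L2 n) ξ := by
  have hcont : Continuous fun ξ : Rn n => (𝐞 (-inner ℝ y ξ) : ℂ) := by fun_prop
  have hmem : ∀ g : L2 n, MemLp (fun ξ => (𝐞 (-inner ℝ y ξ) : ℂ) * g ξ) 2 volume := fun g =>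
    (Lp.memLp g).of_le_mul (c := 1) (hcont.aestronglyMeasurable.mul (Lp.aestronglyMeasurable g))
      (.of_forall fun x => by rw [norm_mul, Circle.norm_coe])
  let modulation : L2 n → L2 n := fun g => (hmem g).toLp
  have hmod : ∀ g, modulation g =ᵐ[volume] fun ξ => (𝐞 (-inner ℝ y ξ) : ℂ) * g ξ := fun g =>
    (hmem g).coeFn_toLp
  -- The identity is checked on Schwartz functions; both sides are isometric, hence
  -- continuous, in `f`.
  have hmc : Continuous modulation := by
    refine Isometry.continuous (Isometry.of_dist_eq fun g g' => ?_)
    rw [dist_eq_norm, dist_eq_norm, Lp.norm_def, Lp.norm_def]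
    congr 1
    refine eLpNorm_congr_norm_ae ?_
    filter_upwards [hmod g, hmod g', Lp.coeFn_sub g g', Lp.coeFn_sub (modulation g) (modulation g')]
      with x h1 h2 h3 h4
    rw [h3, h4, Pi.sub_apply, Pi.sub_apply, h1, h2, ← mul_sub, norm_mul, Circle.norm_coe, one_mul]
  have key : 𝓕 (translation y f) = modulation (𝓕 f) := by
    refine DenseRange.induction_on
      (p := fun f : L2 n => 𝓕 (translation y f) = modulation (𝓕 f))
      (SchwartzMap.denseRange_toLpCLM (F := ℂ) (E := Rn n) (p := 2) (μ := volume)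
        ENNReal.ofNat_ne_top) f
      (isClosed_eq (ContinuousFourier.continuous_fourier.comp (continuous_translation y))
        (hmc.comp ContinuousFourier.continuous_fourier)) fun s => ?_
    change 𝓕 (translation y (s.toLp 2)) = modulation (𝓕 (s.toLp 2))
    have h1 : translation y (s.toLp 2) = (SchwartzMap.compSubConstCLM ℂ y s).toLp 2 := by
      apply Lp.ext
      filter_upwards [coeFn_translation y (s.toLp 2),
        (SchwartzMap.compSubConstCLM ℂ y s).coeFn_toLp 2,
        (measurePreserving_sub_right volume y).quasiMeasurePreserving.ae_eq_comp
          (s.coeFn_toLp 2)] with x h1 h2 h3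
      rw [h1, h2]
      exact h3
    rw [h1, SchwartzMap.toLp_fourier_eq, SchwartzMap.toLp_fourier_eq]
    apply Lp.ext
    filter_upwards [hmod ((𝓕 s).toLp 2), (𝓕 s).coeFn_toLp 2,
      (𝓕 (SchwartzMap.compSubConstCLM ℂ y s)).coeFn_toLp 2] with x h1 h2 h3
    rw [h1, h2, h3, SchwartzMap.fourier_coe, SchwartzMap.fourier_coe,
      Real.fourier_eq, Real.fourier_eq, ← integral_const_mul,
      ← integral_sub_right_eq_self (fun v => _ * _) y]
    refine integral_congr_ae (.of_forall fun v => ?_)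
    simp only [SchwartzMap.compSubConstCLM_apply, Circle.smul_def, smul_eq_mul, ← mul_assoc,
      ← Circle.coe_mul, ← AddChar.map_add_eq_mul, inner_sub_left]
    congr 4
    ring
  rw [key]
  exact hmod _

end Operators

/-! ### Lattices and their duals -/

section Lattices

variable {n : ℕ}

theorem coe_intLattice : (intLattice n : Set (Rn n)) = range intVec := by
  ext x
  constructor
  · intro hx
    choose k hk using hx
    exact ⟨k, by ext i; simp [intVec, castVec, hk]⟩
  · rintro ⟨k, rfl⟩ i
    exact ⟨k i, by simp [intVec, castVec]⟩

theorem injective_intVec : Function.Injective (intVec (n := n)) := by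
  intro k m h
  ext i
  have := congrArg (fun x : Rn n => x i) h
  simpa [intVec, castVec] using this

theorem matImage_intLattice (M : Matrix (Fin n) (Fin n) ℝ) :
    matImage M (intLattice n : Set (Rn n)) = range fun k => Matrix.toEuclideanLin M (intVec k) := by
  rw [matImage, coe_intLattice, ← range_comp]
  rfl

theorem matImage_matImage (M N : Matrix (Fin n) (Fin n) ℝ) (S : Set (Rn n)) :
    matImage M (matImage N S) = matImage (M * N) S := by
  simp only [matImage, image_image, toEuclideanLin_mul_apply]

theorem matImage_one (S : Set (Rn n)) : matImage 1 S = S := by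
  simp only [matImage, toEuclideanLin_one_apply, image_id']

theorem mem_dualLattice {Γ : Submodule ℤ (Rn n)} {η : Rn n} :
    η ∈ dualLattice Γ ↔ ∀ x ∈ Γ, ∃ m : ℤ, inner ℝ η x = m := Iff.rfl

theorem mem_intLattice_iff_inner {x : Rn n} :
    x ∈ intLattice n ↔ ∀ k, ∃ m : ℤ, inner ℝ x (intVec k) = m := by
  constructor
  · intro hx k
    choose a ha using hx
    refine ⟨∑ i, a i * k i, ?_⟩
    simp only [EuclideanSpace.inner_eq_star_dotProduct, dotProduct, intVec, castVec]
    push_cast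
    exact Finset.sum_congr rfl fun i _ => by simp [ha, mul_comm]
  · intro hx i
    obtain ⟨m, hm⟩ := hx (Pi.single i 1)
    refine ⟨m, hm ▸ ?_⟩
    rw [EuclideanSpace.inner_eq_star_dotProduct, dotProduct, Finset.sum_eq_single i]
    · simp [intVec, castVec]
    · intro b _ hb
      simp [intVec, castVec, hb]
    · simp

/-- The dual of the lattice `P ℤⁿ` is `(Pᵀ)⁻¹ ℤⁿ`. -/
theorem coe_dualLattice {Γ : Submodule ℤ (Rn n)} {P : Matrix (Fin n) (Fin n) ℝ} (hP : P.det ≠ 0)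
    (hΓ : (Γ : Set (Rn n)) = matImage P (intLattice n : Set (Rn n))) :
    (dualLattice Γ : Set (Rn n)) = matImage P.transpose⁻¹ (intLattice n : Set (Rn n)) := by
  have hPt : IsUnit P.transpose.det := by simpa using hP.isUnit
  have h1 : ∀ η : Rn n, η ∈ dualLattice Γ ↔ Matrix.toEuclideanLin P.transpose η ∈ intLattice n := by
    intro η
    rw [mem_dualLattice, mem_intLattice_iff_inner]
    simp only [← SetLike.mem_coe, hΓ, matImage_intLattice, forall_mem_range,
      inner_toEuclideanLin_left, Matrix.transpose_transpose]
  ext η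
  rw [SetLike.mem_coe, h1]
  constructor
  · intro h
    refine ⟨_, h, ?_⟩
    simp only [← toEuclideanLin_mul_apply]
    rw [Matrix.nonsing_inv_mul _ hPt, toEuclideanLin_one_apply]
  · rintro ⟨x, hx, rfl⟩
    simp only [← toEuclideanLin_mul_apply]
    rwa [Matrix.mul_nonsing_inv _ hPt, toEuclideanLin_one_apply]

theorem dualLattice_intLattice : dualLattice (intLattice n) = intLattice n := by
  apply SetLike.coe_injective
  rw [coe_dualLattice (P := 1) (by simp) (by rw [matImage_one]), Matrix.transpose_one, inv_one,
    matImage_one]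

theorem dualLattice_anti {Γ Λ : Submodule ℤ (Rn n)} (h : Γ ≤ Λ) : dualLattice Λ ≤ dualLattice Γ :=
  fun _ hη x hx => hη x (h hx)

theorem isZLattice_of_intLattice_le {Λ : Submodule ℤ (Rn n)} (hΛ : intLattice n ≤ Λ)
    [DiscreteTopology Λ] : IsZLattice ℝ Λ := by
  refine ⟨?_⟩
  rw [eq_top_iff, ← (EuclideanSpace.basisFun (Fin n) ℝ).toBasis.span_eq, Submodule.span_le]
  rintro _ ⟨i, rfl⟩
  refine Submodule.subset_span (hΛ fun k => ?_)
  by_cases h : k = i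
  · exact ⟨1, by simp [h]⟩
  · exact ⟨0, by simp [h]⟩

/-- A full-rank lattice is `P ℤⁿ` for an invertible matrix `P`, whose determinant is, up to sign,
the covolume. -/
theorem exists_matrix_of_isZLattice (Λ : Submodule ℤ (Rn n)) [DiscreteTopology Λ]
    [IsZLattice ℝ Λ] : ∃ P : Matrix (Fin n) (Fin n) ℝ, P.det ≠ 0 ∧
      |P.det| = ZLattice.covolume Λ ∧
      (Λ : Set (Rn n)) = matImage P (intLattice n : Set (Rn n)) := by
  let b : Module.Basis (Fin n) ℤ Λ :=
    (Module.Free.chooseBasis ℤ Λ).reindex (Fintype.equivOfCardEq (by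
      rw [← Module.finrank_eq_card_chooseBasisIndex, ZLattice.rank ℝ, finrank_euclideanSpace]))
  let P : Matrix (Fin n) (Fin n) ℝ := Matrix.of fun i k => (b k : Rn n) i
  have hdet : |P.det| = ZLattice.covolume Λ := by
    rw [ZLattice.covolume_eq_det_mul_measureReal Λ volume b
      (EuclideanSpace.basisFun (Fin n) ℝ).toBasis, Module.Basis.det_apply,
      measureReal_congr (ZSpan.fundamentalDomain_ae_parallelepiped _ volume), measureReal_def,
      OrthonormalBasis.coe_toBasis, OrthonormalBasis.volume_parallelepiped, ENNReal.toReal_one,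
      mul_one]
    rfl
  refine ⟨P, fun h => ZLattice.covolume_ne_zero Λ volume ?_, hdet, ?_⟩
  · rw [← hdet, h, abs_zero]
  · have hP : ∀ k, Matrix.toEuclideanLin P (intVec k) = ((∑ i, k i • b i : Λ) : Rn n) := by
      intro k
      ext i
      simp [P, Matrix.mulVec, dotProduct, intVec, castVec, mul_comm]
    rw [matImage_intLattice]
    ext x
    constructor
    · intro hx
      refine ⟨fun i => b.repr ⟨x, hx⟩ i, ?_⟩
      simp only [hP, b.sum_repr]
    · rintro ⟨k, rfl⟩
      simp only [hP]
      exact Subtype.coe_prop _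

end Lattices

/-! ### The energy of a function at one scale -/

section FrequencySide

variable {n : ℕ}

/-- A bounded measurable function supported in the annulus `{r ≤ ‖ξ‖ ≤ R}`. -/
structure IsAnnular (φ : Rn n → ℂ) (r R C : ℝ) : Prop where
  measurable : Measurable φ
  norm_le : ∀ x, ‖φ x‖ ≤ C
  le_norm : ∀ x, φ x ≠ 0 → r ≤ ‖x‖
  norm_le_of_ne_zero : ∀ x, φ x ≠ 0 → ‖x‖ ≤ R

theorem IsAnnular.memLp {φ : Rn n → ℂ} {r R C : ℝ} (hφ : IsAnnular φ r R C) :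
    MemLp φ 2 volume := by
  have hsub : Function.support φ ⊆ Metric.closedBall 0 R := fun x hx => by
    simpa using hφ.norm_le_of_ne_zero x hx
  have : IsFiniteMeasure ((volume : Measure (Rn n)).restrict (Metric.closedBall 0 R)) :=
    ⟨by simpa using measure_closedBall_lt_top (x := (0 : Rn n))⟩
  have h : MemLp φ 2 (volume.restrict (Metric.closedBall 0 R)) :=
    MemLp.of_bound hφ.measurable.aestronglyMeasurable C (.of_forall hφ.norm_le)
  rw [← memLp_indicator_iff_restrict measurableSet_closedBall] at h
  rwa [indicator_eq_self.2 hsub] at h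

/-- The character `ξ ↦ e(⟨x, ξ⟩)` times an annular function is annular. -/
theorem IsAnnular.modulate {φ : Rn n → ℂ} {r R C : ℝ} (hφ : IsAnnular φ r R C) (x : Rn n) :
    IsAnnular (fun ξ => (𝐞 (inner ℝ x ξ) : ℂ) * φ ξ) r R C where
  measurable := by
    have hcont : Continuous fun ξ : Rn n => (𝐞 (inner ℝ x ξ) : ℂ) := by fun_prop
    exact hcont.measurable.mul hφ.measurable
  norm_le ξ := by rw [norm_mul, Circle.norm_coe, one_mul]; exact hφ.norm_le ξ
  le_norm ξ h := hφ.le_norm ξ (right_ne_zero_of_mul h)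
  norm_le_of_ne_zero ξ h := hφ.norm_le_of_ne_zero ξ (right_ne_zero_of_mul h)

/-- The product `ξ ↦ conj(φ(ξ)) g(B⁻ʲ ξ)`: up to the factor `|det B|^{-j/2}`, its integral against
`e(-⟨A⁻ʲ γ, ξ⟩)` is the inner product of `f` with `D_{Aʲ} T_γ ψ`, when `φ` and `g` are the Fourier
transforms of `f` and `ψ` and `B` is the transpose of `A`. -/
noncomputable def scaledProduct (B : Matrix (Fin n) (Fin n) ℝ) (j : ℤ) (φ g : Rn n → ℂ)
    (ξ : Rn n) : ℂ :=
  conj (φ ξ) * g (Matrix.toEuclideanLin (B ^ (-j)) ξ)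

theorem scaledProduct_eq_zero {B : Matrix (Fin n) (Fin n) ℝ} {j : ℤ} {φ g : Rn n → ℂ} {r R C : ℝ}
    (hφ : IsAnnular φ r R C) {ξ : Rn n} (hξ : R < ‖ξ‖) : scaledProduct B j φ g ξ = 0 := by
  have : φ ξ = 0 := by
    by_contra h
    exact absurd (hφ.norm_le_of_ne_zero ξ h) (not_le.2 hξ)
  rw [scaledProduct, this, map_zero, zero_mul]

theorem det_zpow_ne_zero {B : Matrix (Fin n) (Fin n) ℝ} (hB : B.det ≠ 0) (j : ℤ) :
    (B ^ j).det ≠ 0 := by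
  have := (hB.isUnit.det_zpow (A := B) j)
  exact this.ne_zero

theorem memLp_scaledProduct {B : Matrix (Fin n) (Fin n) ℝ} (hB : B.det ≠ 0) (j : ℤ)
    {φ : Rn n → ℂ} {r R C : ℝ} (hφ : IsAnnular φ r R C) {g : Rn n → ℂ} (hg : MemLp g 2 volume) :
    MemLp (scaledProduct B j φ g) 2 volume := by
  have h := memLp_comp_toEuclideanLin (det_zpow_ne_zero hB (-j)) hg
  refine h.of_le_mul (c := C) ((Complex.continuous_conj.measurable.comp
    hφ.measurable).aestronglyMeasurable.mul h.aestronglyMeasurable) (.of_forall fun ξ => ?_)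
  rw [scaledProduct, norm_mul, RCLike.norm_conj]
  exact mul_le_mul_of_nonneg_right (hφ.norm_le ξ) (norm_nonneg _)

/-- Modulating `φ`, that is translating `f`, multiplies the autocorrelation by a character. -/
theorem autocorr_scaledProduct_modulate (B : Matrix (Fin n) (Fin n) ℝ) (j : ℤ) (φ g : Rn n → ℂ)
    (x α : Rn n) :
    autocorr (scaledProduct B j (fun ξ => (𝐞 (inner ℝ x ξ) : ℂ) * φ ξ) g) α =
      (𝐞 (-inner ℝ x α) : ℂ) * autocorr (scaledProduct B j φ g) α := by
  rw [autocorr, autocorr, ← integral_const_mul]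
  refine integral_congr_ae (.of_forall fun ξ => ?_)
  have h : (𝐞 (-inner ℝ x α) : ℂ) =
      conj (𝐞 (inner ℝ x (ξ + α)) : ℂ) * (𝐞 (inner ℝ x ξ) : ℂ) := by
    rw [← Circle.coe_inv_eq_conj, ← AddChar.map_neg_eq_inv, ← Circle.coe_mul,
      ← AddChar.map_add_eq_mul, inner_add_right]
    congr 2
    ring
  simp only [scaledProduct, map_mul, Complex.conj_conj, h]
  ring

/-- The inner products with the wavelets, by Plancherel's theorem. -/
theorem inner_dilation_translation {A : GL (Fin n) ℝ} {f ψ : L2 n} {φ : Rn n → ℂ}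
    (hf : (𝓕 f : L2 n) =ᵐ[volume] φ) (j : ℤ) (y : Rn n) :
    ‖inner ℂ f (dilation (A ^ j) (translation y ψ))‖ ^ 2 =
      |((A : Matrix (Fin n) (Fin n) ℝ).transpose ^ (-j)).det| *
      ‖∫ ξ, (𝐞 (-inner ℝ (Matrix.toEuclideanLin ((A : Matrix (Fin n) (Fin n) ℝ) ^ (-j)) y) ξ) : ℂ) *
        scaledProduct (A : Matrix (Fin n) (Fin n) ℝ).transpose j φ (𝓕 ψ : L2 n) ξ‖ ^ 2 := by
  have hAu : IsUnit (A : Matrix (Fin n) (Fin n) ℝ).transpose.det := by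
    simpa using (det_coe_ne_zero A).isUnit
  set B := (A : Matrix (Fin n) (Fin n) ℝ).transpose with hB
  let B' : GL (Fin n) ℝ := Matrix.GeneralLinearGroup.mkOfDetNeZero (B ^ (-j))
    (det_zpow_ne_zero hAu.ne_zero _)
  have hB' : (B' : Matrix (Fin n) (Fin n) ℝ) = B ^ (-j) := rfl
  have h1 : (B' : Matrix (Fin n) (Fin n) ℝ) =
      ((A ^ j : GL (Fin n) ℝ) : Matrix (Fin n) (Fin n) ℝ).transpose⁻¹ := by
    rw [hB', Matrix.coe_units_zpow, Matrix.transpose_zpow, Matrix.zpow_neg hAu]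
  have hAt : ((A : Matrix (Fin n) (Fin n) ℝ) ^ (-j)).transpose = B ^ (-j) := by
    rw [Matrix.transpose_zpow]
  have h2 : inner ℂ f (dilation (A ^ j) (translation y ψ)) =
      (Real.sqrt |(B ^ (-j)).det| : ℂ) *
        ∫ ξ, (𝐞 (-inner ℝ (Matrix.toEuclideanLin
            ((A : Matrix (Fin n) (Fin n) ℝ) ^ (-j)) y) ξ) : ℂ) *
          scaledProduct B j φ (𝓕 ψ : L2 n) ξ := by
    rw [← Lp.inner_fourier_eq, fourier_dilation h1, L2.inner_def, ← integral_const_mul]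
    refine integral_congr_ae ?_
    filter_upwards [hf, coeFn_dilation B' (𝓕 (translation y ψ)),
      ae_comp_toEuclideanLin (det_coe_ne_zero B') (coeFn_fourier_translation y ψ)] with ξ e1 e2 e3
    rw [e1, e2, e3, hB', scaledProduct, inner_toEuclideanLin_left, hAt, RCLike.inner_apply]
    ring
  rw [h2, norm_mul, mul_pow, Complex.norm_real, Real.norm_eq_abs, sq_abs,
    Real.sq_sqrt (abs_nonneg _)]

/-- At a fixed scale, the energy of `f` over the lattice `Γ` is the sum of an autocorrelation over
the dilated dual lattice; the autocorrelation does not depend on `Γ`. -/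
theorem hasSum_sq_inner_lattice {A : GL (Fin n) ℝ} {f ψ : L2 n} {φ : Rn n → ℂ} {r R C : ℝ}
    (hφ : IsAnnular φ r R C) (hf : (𝓕 f : L2 n) =ᵐ[volume] φ)
    {Γ : Submodule ℤ (Rn n)} {P : Matrix (Fin n) (Fin n) ℝ} (hP : P.det ≠ 0)
    (hΓ : (Γ : Set (Rn n)) = matImage P (intLattice n : Set (Rn n))) (j : ℤ) :
    ∃ W : ℝ, HasSum (fun γ : Γ => ‖inner ℂ f (dilation (A ^ j) (translation (γ : Rn n) ψ))‖ ^ 2)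
        (|P.det|⁻¹ * W) ∧
      HasSum ((matImage ((A : Matrix (Fin n) (Fin n) ℝ).transpose ^ j)
          (dualLattice Γ : Set (Rn n))).indicator
        (autocorr (scaledProduct (A : Matrix (Fin n) (Fin n) ℝ).transpose j φ (𝓕 ψ : L2 n))))
        (W : ℂ) := by
  have hA := det_coe_ne_zero A
  have hB : (A : Matrix (Fin n) (Fin n) ℝ).transpose.det ≠ 0 := by simpa using hA
  set B := (A : Matrix (Fin n) (Fin n) ℝ).transpose with hBdef
  set M := (A : Matrix (Fin n) (Fin n) ℝ) ^ (-j) * P with hM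
  have hMdet : M.det ≠ 0 := by
    rw [hM, Matrix.det_mul]
    exact mul_ne_zero (det_zpow_ne_zero hA _) hP
  have hMt : M.transpose⁻¹ = B ^ j * P.transpose⁻¹ := by
    rw [hM, Matrix.transpose_mul, Matrix.mul_inv_rev, Matrix.transpose_zpow,
      ← Matrix.zpow_neg hB.isUnit, neg_neg]
  obtain ⟨W, h1, h2⟩ := hasSum_sq_integral_lattice hMdet
    (memLp_scaledProduct hB j hφ (Lp.memLp (𝓕 ψ : L2 n)))
    (fun x hx => scaledProduct_eq_zero hφ hx)
  refine ⟨W, ?_, ?_⟩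
  · have e1 : HasSum (fun γ : (Γ : Set (Rn n)) =>
        ‖inner ℂ f (dilation (A ^ j) (translation (γ : Rn n) ψ))‖ ^ 2) (|P.det|⁻¹ * W) := by
      rw [hΓ, matImage_intLattice]
      refine (Function.Injective.hasSum_range_iff
        (f := fun γ : Rn n => ‖inner ℂ f (dilation (A ^ j) (translation γ ψ))‖ ^ 2)
        (g := fun k => Matrix.toEuclideanLin P (intVec k))
        ((injective_toEuclideanLin hP).comp injective_intVec)).2 ?_
      have h3 := h1.mul_left |(B ^ (-j)).det|
      have h4 : |(B ^ (-j)).det| * (|M.det|⁻¹ * W) = |P.det|⁻¹ * W := by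
        have h5 : (B ^ (-j)).det = ((A : Matrix (Fin n) (Fin n) ℝ) ^ (-j)).det := by
          rw [hBdef, ← Matrix.transpose_zpow, Matrix.det_transpose]
        have h6 := abs_pos.2 (det_zpow_ne_zero hA (-j))
        rw [h5, hM, Matrix.det_mul, abs_mul, mul_inv, ← mul_assoc, ← mul_assoc,
          mul_inv_cancel₀ h6.ne', one_mul]
      rw [h4] at h3
      refine h3.congr_fun fun k => ?_
      simp only [Function.comp, inner_dilation_translation hf]
      rw [← hBdef, hM]
      simp only [toEuclideanLin_mul_apply]
    exact e1
  · rw [coe_dualLattice hP hΓ, matImage_matImage, ← hMt, matImage_intLattice]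
    have hinj : Function.Injective fun k => Matrix.toEuclideanLin M.transpose⁻¹ (intVec k) :=
      (injective_toEuclideanLin (by
        simpa [Matrix.det_nonsing_inv] using hMdet)).comp injective_intVec
    rw [← hasSum_subtype_iff_indicator]
    exact hinj.hasSum_range_iff.2 h2

end FrequencySide

/-! ### Uniqueness of trigonometric series -/

section AlmostPeriodic

variable {n : ℕ}

theorem integral_fourierChar_stdGaussian (β : Rn n) (t : ℝ) :
    ∫ y : Rn n, (𝐞 (inner ℝ (t • y) β) : ℂ) ∂(ProbabilityTheory.stdGaussian (Rn n)) =
      Complex.exp (-(‖(2 * π * t) • β‖ ^ 2 : ℝ) / 2) := by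
  have h := ProbabilityTheory.charFun_stdGaussian (E := Rn n) ((2 * π * t) • β)
  rw [charFun_apply] at h
  push_cast
  rw [← h]
  refine integral_congr_ae (.of_forall fun y => ?_)
  simp only [Real.fourierChar_apply, inner_smul_left, inner_smul_right]
  congr 1
  simp
  ring

/-- An absolutely convergent trigonometric series on `ℝⁿ` with a constant sum has no nonzero
frequency: averaging against Gaussians of growing variance isolates each coefficient. -/
theorem eq_zero_of_tsum_fourierChar_eq {c : Rn n → ℂ} (hc : Summable c) {N : ℂ}
    (h : ∀ x, ∑' α, (𝐞 (-inner ℝ x α) : ℂ) * c α = N) {β : Rn n} (hβ : β ≠ 0) : c β = 0 := by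
  let μ := ProbabilityTheory.stdGaussian (Rn n)
  let G : ℕ → Rn n → ℂ := fun k v => Complex.exp (-(‖(2 * π * k) • v‖ ^ 2 : ℝ) / 2)
  have hGnorm : ∀ k v, ‖G k v‖ ≤ 1 := fun k v => by
    have : (-(‖(2 * π * k) • v‖ ^ 2 : ℝ) / 2 : ℂ) = ((-(‖(2 * π * k) • v‖ ^ 2) / 2 : ℝ) : ℂ) := by
      push_cast; rfl
    simp only [G]
    rw [this, ← Complex.ofReal_exp, Complex.norm_real, Real.norm_eq_abs, Real.abs_exp,
      Real.exp_le_one_iff]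
    have := sq_nonneg ‖(2 * π * k) • v‖
    linarith
  have hGlim : ∀ v ≠ 0, Tendsto (fun k => G k v) atTop (𝓝 0) := fun v hv => by
    have h1 : Tendsto (fun k : ℕ => -(‖(2 * π * k) • v‖ ^ 2) / 2) atTop atBot := by
      have h2 : ∀ k : ℕ, -(‖(2 * π * (k : ℝ)) • v‖ ^ 2) / 2 =
          -((k : ℝ) ^ 2 * (2 * π ^ 2 * ‖v‖ ^ 2)) := by
        intro k
        rw [norm_smul, mul_pow, Real.norm_eq_abs, sq_abs]
        ring
      simp_rw [h2]
      refine tendsto_neg_atTop_atBot.comp (Tendsto.atTop_mul_const ?_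
        ((tendsto_pow_atTop two_ne_zero).comp tendsto_natCast_atTop_atTop))
      have := norm_pos_iff.2 hv
      positivity
    have h3 := (Complex.continuous_ofReal.tendsto 0).comp (Real.tendsto_exp_atBot.comp h1)
    refine h3.congr fun k => ?_
    simp [G]
  have hsupp : ∀ F : Rn n → ℂ,
      ∑' α : Function.support c, c α * F α = ∑' α, c α * F α := fun F =>
    tsum_subtype_eq_of_support_subset (f := fun α => c α * F α) (s := Function.support c)
      fun α hα => left_ne_zero_of_mul hα
  have key : ∀ k : ℕ, ∑' α, c α * G k (β - α) = N * G k β := by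
    intro k
    have hint : ∀ v : Rn n, Integrable (fun y => (𝐞 (inner ℝ ((k : ℝ) • y) v) : ℂ)) μ := fun v =>
      (integrable_const (1 : ℝ)).mono'
        (by have : Continuous fun y : Rn n => (𝐞 (inner ℝ ((k : ℝ) • y) v) : ℂ) := by fun_prop
            exact this.aestronglyMeasurable)
        (.of_forall fun y => by rw [Circle.norm_coe])
    -- Only countably many coefficients are nonzero, so sum and integral may be interchanged.
    have hcount : Countable (Function.support c) := hc.countable_support.to_subtype
    have hs := hasSum_integral_of_summable_integral_norm (μ := μ)
      (F := fun (α : Function.support c) y => c α * (𝐞 (inner ℝ ((k : ℝ) • y) (β - α)) : ℂ))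
      (fun α => (hint _).const_mul _) (by
        simp only [norm_mul, Circle.norm_coe, mul_one, integral_const, probReal_univ, one_smul]
        exact hc.norm.subtype _)
    have h1 : ∀ y : Rn n, ∑' α : Function.support c,
        c α * (𝐞 (inner ℝ ((k : ℝ) • y) (β - (α : Rn n))) : ℂ) =
          N * (𝐞 (inner ℝ ((k : ℝ) • y) β) : ℂ) := by
      intro y
      rw [hsupp fun α => (𝐞 (inner ℝ ((k : ℝ) • y) (β - α)) : ℂ), ← h ((k : ℝ) • y),
        ← tsum_mul_right]
      refine tsum_congr fun α => ?_
      rw [mul_right_comm, ← Circle.coe_mul, ← AddChar.map_add_eq_mul, inner_sub_right, mul_comm]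
      congr 3
      ring
    simp_rw [h1, integral_const_mul] at hs
    have h2 := hs.tsum_eq
    simp only [μ, integral_fourierChar_stdGaussian] at h2
    rw [← h2, hsupp fun α => Complex.exp (-(‖(2 * π * k) • (β - α)‖ ^ 2 : ℝ) / 2)]
  have hlim1 : Tendsto (fun k : ℕ => ∑' α, c α * G k (β - α)) atTop
      (𝓝 (∑' α, if α = β then c β else 0)) := by
    refine tendsto_tsum_of_dominated_convergence (bound := fun α => ‖c α‖) hc.norm ?_ ?_
    · intro α
      split_ifs with hα
      · subst hα
        simp [G]
      · simpa using (hGlim (β - α) (sub_ne_zero.2 (Ne.symm hα))).const_mul (c α)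
    · refine .of_forall fun k α => ?_
      rw [norm_mul]
      exact mul_le_of_le_one_right (norm_nonneg _) (hGnorm _ _)
  have hlim2 : Tendsto (fun k : ℕ => N * G k β) atTop (𝓝 0) := by
    simpa using (hGlim β hβ).const_mul N
  rw [tsum_ite_eq] at hlim1
  exact tendsto_nhds_unique hlim1 (hlim2.congr fun k => (key k).symm)

end AlmostPeriodic

/-! ### Powers of an expansive matrix -/

section Expansive

variable {n : ℕ}

/-- The powers of an element of spectral radius less than `1` tend to `0` (Gelfand's formula). -/
theorem tendsto_pow_of_spectralRadius_lt_one {𝔸 : Type*} [NormedRing 𝔸] [NormedAlgebra ℂ 𝔸]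
    [CompleteSpace 𝔸] {a : 𝔸} (ha : spectralRadius ℂ a < 1) :
    Tendsto (fun k : ℕ => a ^ k) atTop (𝓝 0) := by
  obtain ⟨r, hr1, hr2⟩ := ENNReal.lt_iff_exists_nnreal_btwn.1 ha
  have h1 := (spectrum.pow_nnnorm_pow_one_div_tendsto_nhds_spectralRadius a).eventually_lt_const hr1
  have hr : r < 1 := by exact_mod_cast hr2
  rw [tendsto_zero_iff_norm_tendsto_zero]
  refine squeeze_zero' (.of_forall fun k => norm_nonneg _) ?_
    (tendsto_pow_atTop_nhds_zero_of_lt_one r.2 (by exact_mod_cast hr))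
  filter_upwards [h1, eventually_gt_atTop 0] with k hk hk0
  have hk' : (0 : ℝ) < k := by exact_mod_cast hk0
  have h2 := ENNReal.rpow_le_rpow hk.le hk'.le
  rw [← ENNReal.rpow_mul, one_div, inv_mul_cancel₀ hk'.ne', ENNReal.rpow_one,
    ENNReal.rpow_natCast] at h2
  exact_mod_cast h2

/-- The operator norm of the `j`-th power of the matrix `B` on Euclidean space. -/
noncomputable def zpowNorm (B : Matrix (Fin n) (Fin n) ℝ) (j : ℤ) : ℝ :=
  ‖LinearMap.toContinuousLinearMap (Matrix.toEuclideanLin (B ^ j))‖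

theorem norm_zpow_apply_le (B : Matrix (Fin n) (Fin n) ℝ) (j : ℤ) (x : Rn n) :
    ‖Matrix.toEuclideanLin (B ^ j) x‖ ≤ zpowNorm B j * ‖x‖ :=
  (LinearMap.toContinuousLinearMap (Matrix.toEuclideanLin (B ^ j))).le_opNorm x

theorem zpowNorm_nonneg (B : Matrix (Fin n) (Fin n) ℝ) (j : ℤ) : 0 ≤ zpowNorm B j :=
  norm_nonneg _

theorem zpow_add_apply {B : Matrix (Fin n) (Fin n) ℝ} (hB : B.det ≠ 0) (i j : ℤ) (x : Rn n) :
    Matrix.toEuclideanLin (B ^ (i + j)) x =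
      Matrix.toEuclideanLin (B ^ i) (Matrix.toEuclideanLin (B ^ j) x) := by
  rw [Matrix.zpow_add hB.isUnit, toEuclideanLin_mul_apply]

theorem zpow_neg_apply_zpow_apply {B : Matrix (Fin n) (Fin n) ℝ} (hB : B.det ≠ 0) (j : ℤ)
    (x : Rn n) : Matrix.toEuclideanLin (B ^ (-j)) (Matrix.toEuclideanLin (B ^ j) x) = x := by
  rw [← zpow_add_apply hB, neg_add_cancel, zpow_zero, toEuclideanLin_one_apply]

theorem zpow_apply_zpow_neg_apply {B : Matrix (Fin n) (Fin n) ℝ} (hB : B.det ≠ 0) (j : ℤ)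
    (x : Rn n) : Matrix.toEuclideanLin (B ^ j) (Matrix.toEuclideanLin (B ^ (-j)) x) = x := by
  rw [← zpow_add_apply hB, add_neg_cancel, zpow_zero, toEuclideanLin_one_apply]

/-- The eigenvalues of the inverse of an expansive matrix have modulus less than `1`, so that its
powers tend to `0`. -/
theorem tendsto_zpowNorm_of_isExpansive [NeZero n] (A : GL (Fin n) ℝ)
    (hA : IsExpansive (A : Matrix (Fin n) (Fin n) ℝ)) :
    Tendsto (fun k : ℕ => zpowNorm (A : Matrix (Fin n) (Fin n) ℝ).transpose (-(k : ℤ)))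
      atTop (𝓝 0) := by
  let _ : NormedRing (Matrix (Fin n) (Fin n) ℂ) := Matrix.linftyOpNormedRing
  let _ : NormedAlgebra ℂ (Matrix (Fin n) (Fin n) ℂ) := Matrix.linftyOpNormedAlgebra
  let Ac : (Matrix (Fin n) (Fin n) ℂ)ˣ :=
    Units.map ((algebraMap ℝ ℂ).mapMatrix : Matrix (Fin n) (Fin n) ℝ →+* _).toMonoidHom A
  let a : Matrix (Fin n) (Fin n) ℂ := ((Ac⁻¹ : (Matrix (Fin n) (Fin n) ℂ)ˣ) : _)
  have hρ : spectralRadius ℂ a < 1 := by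
    refine spectrum.spectralRadius_lt_of_forall_lt a (r := 1) fun z hz => ?_
    have hz' := spectrum.inv₀_mem_iff.2 hz
    have h1 := hA _ hz'
    rw [norm_inv] at h1
    have hz0 : 0 < ‖z‖ := by
      by_contra! h
      rw [norm_le_zero_iff.1 h] at h1
      norm_num at h1
    have : ‖z‖ < 1 := (one_lt_inv₀ hz0).1 h1
    exact_mod_cast this
  -- Real part and transposition, as a continuous map into the operators on Euclidean space.
  let T : Matrix (Fin n) (Fin n) ℂ →ₗ[ℝ] (Rn n →L[ℝ] Rn n) :=
    { toFun := fun M => LinearMap.toContinuousLinearMap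
        (Matrix.toEuclideanLin (M.map Complex.re).transpose)
      map_add' := fun M N => by
        rw [Matrix.map_add _ Complex.add_re, Matrix.transpose_add, map_add, map_add]
      map_smul' := fun c M => by
        rw [Matrix.map_smul _ c (fun z => by simp), Matrix.transpose_smul, map_smul, map_smul]
        rfl }
  have hT : Continuous T := LinearMap.continuous_of_finiteDimensional T
  have h := ((hT.tendsto 0).comp (tendsto_pow_of_spectralRadius_lt_one hρ)).norm
  rw [map_zero, norm_zero] at h
  refine h.congr fun k => ?_
  have h2 : a ^ k = ((A : Matrix (Fin n) (Fin n) ℝ) ^ (-(k : ℤ))).map (algebraMap ℝ ℂ) := by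
    rw [← Matrix.coe_units_zpow]
    simp only [a, Ac, ← Units.val_pow_eq_pow_val, ← map_inv, ← map_pow]
    rw [Units.coe_map, zpow_neg, zpow_natCast, inv_pow]
    rfl
  have h3 : (a ^ k).map Complex.re = (A : Matrix (Fin n) (Fin n) ℝ) ^ (-(k : ℤ)) := by
    rw [h2]
    ext i j
    simp
  simp only [Function.comp, T, LinearMap.coe_mk, AddHom.coe_mk, zpowNorm]
  rw [h3, Matrix.transpose_zpow]

end Expansive

/-! ### Lattice point counts and absolute summability -/

section Summability

variable {n : ℕ}

theorem one_le_norm_intVec {k : Fin n → ℤ} (hk : k ≠ 0) : 1 ≤ ‖intVec k‖ := by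
  obtain ⟨i, hi⟩ := Function.ne_iff.1 hk
  have h1 := PiLp.norm_apply_le (intVec k) i
  refine le_trans ?_ h1
  have : (1 : ℤ) ≤ |k i| := Int.one_le_abs hi
  have h2 : ‖(intVec k : Rn n) i‖ = ((|k i| : ℤ) : ℝ) := by
    simp [intVec, castVec]
  rw [h2]
  exact_mod_cast this

theorem intVec_sub (k m : Fin n → ℤ) : intVec (k - m) = intVec k - intVec m := by
  ext i
  simp [intVec, castVec]

/-- Lattice points are at mutual distance at least `1`, so that those mapped into a ball by `Bʲ` can
be counted by comparing volumes. -/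
theorem tsum_indicator_mul_le {B : Matrix (Fin n) (Fin n) ℝ} (hB : B.det ≠ 0) {j : ℤ} {ρ C₀ : ℝ}
    (hC₀ : 0 < C₀) (hC : zpowNorm B j ≤ C₀) :
    (∑' k : Fin n → ℤ, {k | ‖Matrix.toEuclideanLin (B ^ j) (intVec k)‖ ≤ ρ}.indicator
        (fun _ => (1 : ℝ≥0∞)) k) * volume (Metric.ball (0 : Rn n) (1 / 2)) ≤
      ENNReal.ofReal |(B ^ j).det|⁻¹ * volume (Metric.ball (0 : Rn n) (ρ + C₀)) := by
  set T : Set (Fin n → ℤ) := {k | ‖Matrix.toEuclideanLin (B ^ j) (intVec k)‖ ≤ ρ}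
  have h1 : ENNReal.ofReal |(B ^ j).det|⁻¹ * volume (Metric.ball (0 : Rn n) (ρ + C₀)) =
      volume (Matrix.toEuclideanLin (B ^ j) ⁻¹' Metric.ball (0 : Rn n) (ρ + C₀)) := by
    rw [Measure.addHaar_preimage_linearMap _ (by
      rw [det_toEuclideanLin]; exact det_zpow_ne_zero hB j), det_toEuclideanLin, abs_inv]
  rw [h1, ← tsum_subtype, ← ENNReal.tsum_mul_right]
  have h2 : ∀ k : T, (1 : ℝ≥0∞) * volume (Metric.ball (0 : Rn n) (1 / 2)) =
      volume (Metric.ball (intVec (k : Fin n → ℤ)) (1 / 2)) := fun k => by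
    rw [one_mul, Measure.addHaar_ball_center volume (intVec (k : Fin n → ℤ))]
  rw [tsum_congr h2]
  refine (tsum_meas_le_meas_iUnion_of_disjoint volume (fun _ => measurableSet_ball)
    fun k m hkm => ?_).trans (measure_mono (iUnion_subset fun k x hx => ?_))
  · refine Metric.ball_disjoint_ball ?_
    rw [dist_eq_norm, ← intVec_sub]
    have := one_le_norm_intVec (sub_ne_zero.2 (Subtype.coe_ne_coe.2 hkm))
    linarith
  · have hk : ‖Matrix.toEuclideanLin (B ^ j) (intVec (k : Fin n → ℤ))‖ ≤ ρ := k.2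
    rw [mem_ball_iff_norm] at hx
    rw [mem_preimage, mem_ball_zero_iff]
    have h3 : Matrix.toEuclideanLin (B ^ j) x = Matrix.toEuclideanLin (B ^ j) (x - intVec k) +
      Matrix.toEuclideanLin (B ^ j) (intVec k) := by rw [← map_add, sub_add_cancel]
    have h4 := norm_zpow_apply_le B j (x - intVec k)
    have h5 : zpowNorm B j * ‖x - intVec k‖ ≤ C₀ * (1 / 2) :=
      mul_le_mul hC hx.le (norm_nonneg _) hC₀.le
    rw [h3]
    have h6 := norm_add_le (Matrix.toEuclideanLin (B ^ j) (x - intVec k))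
      (Matrix.toEuclideanLin (B ^ j) (intVec (k : Fin n → ℤ)))
    linarith

/-- The estimate `ab ≤ a² + b²`, cruder than the Cauchy-Schwarz inequality, costs a factor `2`. -/
theorem enorm_autocorr_le {h : Rn n → ℂ} (hh : AEMeasurable h volume) (α : Rn n) :
    ‖autocorr h α‖ₑ ≤ 2 * ∫⁻ ξ, ‖h ξ‖ₑ ^ 2 := by
  refine (enorm_integral_le_lintegral_enorm _).trans ?_
  have h1 : ∀ a b : ℝ≥0∞, a * b ≤ a ^ 2 + b ^ 2 := fun a b => by
    rcases le_total a b with h | h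
    · calc a * b ≤ b * b := by gcongr
        _ = b ^ 2 := (sq b).symm
        _ ≤ _ := le_add_self
    · calc a * b ≤ a * a := by gcongr
        _ = a ^ 2 := (sq a).symm
        _ ≤ _ := le_self_add
  calc ∫⁻ ξ, ‖h (ξ + α) * conj (h ξ)‖ₑ ≤ ∫⁻ ξ, (‖h (ξ + α)‖ₑ ^ 2 + ‖h ξ‖ₑ ^ 2) :=
        lintegral_mono fun ξ => by
          rw [enorm_mul, RCLike.enorm_conj]
          exact h1 _ _
    _ = (∫⁻ ξ, ‖h (ξ + α)‖ₑ ^ 2) + ∫⁻ ξ, ‖h ξ‖ₑ ^ 2 :=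
        lintegral_add_right' _ (hh.enorm.pow_const 2)
    _ = 2 * ∫⁻ ξ, ‖h ξ‖ₑ ^ 2 := by
        rw [lintegral_add_right_eq_self (fun ξ => ‖h ξ‖ₑ ^ 2) α, two_mul]

theorem autocorr_eq_zero {h : Rn n → ℂ} {R : ℝ} (hR : ∀ x, R < ‖x‖ → h x = 0) {α : Rn n}
    (hα : 2 * R < ‖α‖) : autocorr h α = 0 := by
  refine integral_eq_zero_of_ae (.of_forall fun ξ => ?_)
  rcases lt_or_ge R ‖ξ‖ with h1 | h1
  · simp [hR ξ h1]
  · have : R < ‖ξ + α‖ := by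
      have := norm_sub_le (ξ + α) ξ
      rw [add_sub_cancel_left] at this
      linarith
    simp [hR _ this]

/-- The annulus `{r ≤ ‖ξ‖ ≤ R}`. -/
def annulus (n : ℕ) (r R : ℝ) : Set (Rn n) := {ξ | r ≤ ‖ξ‖ ∧ ‖ξ‖ ≤ R}

theorem measurableSet_annulus (r R : ℝ) : MeasurableSet (annulus n r R) :=
  ((isClosed_le continuous_const continuous_norm).inter
    (isClosed_le continuous_norm continuous_const)).measurableSet

/-- The energy of `g` in the image of the annulus under `B⁻ʲ`. -/
noncomputable def annulusEnergy (B : Matrix (Fin n) (Fin n) ℝ) (r R : ℝ) (g : Rn n → ℂ) (j : ℤ) :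
    ℝ≥0∞ :=
  ∫⁻ η, (annulus n r R).indicator (fun _ => (1 : ℝ≥0∞)) (Matrix.toEuclideanLin (B ^ j) η) *
    ‖g η‖ₑ ^ 2

theorem lintegral_scaledProduct_le {B : Matrix (Fin n) (Fin n) ℝ} (hB : B.det ≠ 0) (j : ℤ)
    {φ : Rn n → ℂ} {r R C : ℝ} (hφ : IsAnnular φ r R C) (g : Rn n → ℂ) :
    ∫⁻ ξ, ‖scaledProduct B j φ g ξ‖ₑ ^ 2 ≤
      ENNReal.ofReal C ^ 2 * (ENNReal.ofReal |(B ^ j).det| * annulusEnergy B r R g j) := by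
  have h := lintegral_comp_toEuclideanLin (det_zpow_ne_zero hB (-j)) fun η =>
    (annulus n r R).indicator (fun _ => (1 : ℝ≥0∞)) (Matrix.toEuclideanLin (B ^ j) η) * ‖g η‖ₑ ^ 2
  have hdet : |(B ^ (-j)).det|⁻¹ = |(B ^ j).det| := by
    rw [Matrix.zpow_neg hB.isUnit, Matrix.det_nonsing_inv, Ring.inverse_eq_inv', abs_inv, inv_inv]
  simp only [zpow_apply_zpow_neg_apply hB, hdet] at h
  rw [annulusEnergy, ← h, ← lintegral_const_mul' _ _ (by finiteness)]
  refine lintegral_mono fun ξ => ?_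
  rw [scaledProduct, enorm_mul, RCLike.enorm_conj, mul_pow]
  by_cases h0 : φ ξ = 0
  · simp [h0]
  · have h1 : ξ ∈ annulus n r R := ⟨hφ.le_norm ξ h0, hφ.norm_le_of_ne_zero ξ h0⟩
    rw [indicator_of_mem h1, one_mul]
    gcongr
    rw [← ofReal_norm]
    exact ENNReal.ofReal_le_ofReal (hφ.norm_le ξ)

/-- The preimages of an annulus under the powers of `B` overlap boundedly, as high powers of `B⁻¹`
are contractions. -/
theorem tsum_annulusEnergy_lt_top {B : Matrix (Fin n) (Fin n) ℝ} (hB : B.det ≠ 0)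
    (hlim : Tendsto (fun k : ℕ => zpowNorm B (-(k : ℤ))) atTop (𝓝 0)) {r R : ℝ} (hr : 0 < r)
    {g : Rn n → ℂ} (hg : MemLp g 2 volume) :
    ∑' j : ℤ, annulusEnergy B r R g j < ⊤ := by
  have hlim' : Tendsto (fun k : ℕ => zpowNorm B (-(k : ℤ)) * R) atTop (𝓝 0) := by
    simpa using hlim.mul_const R
  obtain ⟨N, hN⟩ := eventually_atTop.1 (hlim'.eventually_lt_const hr)
  -- Beyond `N` steps, the powers of `B⁻¹` map the annulus into the ball of radius `r`.
  have hsep : ∀ η : Rn n, ∀ i j : ℤ, Matrix.toEuclideanLin (B ^ i) η ∈ annulus n r R →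
      Matrix.toEuclideanLin (B ^ j) η ∈ annulus n r R → j ≤ i + N := by
    intro η i j hi hj
    by_contra! hlt
    obtain ⟨k, hk⟩ := Int.eq_ofNat_of_zero_le (show 0 ≤ j - i by omega)
    have h1 := norm_zpow_apply_le B (-(k : ℤ)) (Matrix.toEuclideanLin (B ^ j) η)
    rw [← zpow_add_apply hB, show -(k : ℤ) + j = i by omega] at h1
    have h2 : zpowNorm B (-(k : ℤ)) * ‖Matrix.toEuclideanLin (B ^ j) η‖ ≤
        zpowNorm B (-(k : ℤ)) * R := mul_le_mul_of_nonneg_left hj.2 (zpowNorm_nonneg _ _)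
    have h3 := hN k (by omega)
    linarith [hi.1]
  have hle : ∀ η : Rn n, (annulus n r R).indicator (fun _ => (1 : ℝ≥0∞)) η ≤ 1 := fun η =>
    indicator_apply_le' (fun _ => le_rfl) (fun _ => zero_le_one)
  have hov : ∀ η : Rn n, ∑' j : ℤ, (annulus n r R).indicator (fun _ => (1 : ℝ≥0∞))
      (Matrix.toEuclideanLin (B ^ j) η) ≤ 2 * N + 1 := by
    intro η
    by_cases h : ∃ i : ℤ, Matrix.toEuclideanLin (B ^ i) η ∈ annulus n r R
    · obtain ⟨i, hi⟩ := h
      rw [tsum_eq_sum (s := Finset.Icc (i - N) (i + N)) fun j hj => ?_]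
      · refine (Finset.sum_le_sum (g := fun _ => (1 : ℝ≥0∞)) fun j _ => hle _).trans ?_
        rw [Finset.sum_const, Int.card_Icc, nsmul_one]
        have : (i + N + 1 - (i - N)).toNat = 2 * N + 1 := by omega
        rw [this]
        push_cast
        rfl
      · refine indicator_of_notMem (fun hj' => hj (Finset.mem_Icc.2 ⟨?_, hsep η i j hi hj'⟩)) _
        have := hsep η j i hj' hi
        omega
    · push Not at h
      simp [h]
  have hmeas : ∀ j : ℤ, Measurable fun η : Rn n => (annulus n r R).indicator
      (fun _ => (1 : ℝ≥0∞)) (Matrix.toEuclideanLin (B ^ j) η) := fun j =>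
    (measurable_const.indicator (measurableSet_annulus r R)).comp (measurable_toEuclideanLin _)
  have hg2 : AEMeasurable (fun η => ‖g η‖ₑ ^ 2) volume :=
    hg.aestronglyMeasurable.aemeasurable.enorm.pow_const 2
  simp only [annulusEnergy]
  rw [← lintegral_tsum (f := fun (j : ℤ) η => (annulus n r R).indicator (fun _ => (1 : ℝ≥0∞))
    (Matrix.toEuclideanLin (B ^ j) η) * ‖g η‖ₑ ^ 2) fun j => (hmeas j).aemeasurable.mul hg2]
  simp_rw [ENNReal.tsum_mul_right]
  calc ∫⁻ η, (∑' j : ℤ, (annulus n r R).indicator (fun _ => (1 : ℝ≥0∞))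
        (Matrix.toEuclideanLin (B ^ j) η)) * ‖g η‖ₑ ^ 2
      ≤ ∫⁻ η, (2 * N + 1) * ‖g η‖ₑ ^ 2 := lintegral_mono fun η => mul_le_mul_left (hov η) _
    _ = (2 * N + 1) * ∫⁻ η, ‖g η‖ₑ ^ 2 := lintegral_const_mul' _ _ (by finiteness)
    _ < ⊤ := by
      refine ENNReal.mul_lt_top (by finiteness) ?_
      have := hg.eLpNorm_lt_top
      rw [eLpNorm_lt_top_iff_lintegral_rpow_enorm_lt_top two_ne_zero ENNReal.ofNat_ne_top] at this
      simpa using this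

theorem intVec_zero : intVec (0 : Fin n → ℤ) = 0 := by
  ext i
  simp [intVec, castVec]

theorem tsum_enorm_indicator_matImage {M : Matrix (Fin n) (Fin n) ℝ} (hM : M.det ≠ 0)
    (c : Rn n → ℂ) :
    ∑' α, ‖(matImage M (intLattice n : Set (Rn n))).indicator c α‖ₑ =
      ∑' k : Fin n → ℤ, ‖c (Matrix.toEuclideanLin M (intVec k))‖ₑ := by
  have h1 : ∀ α, ‖(matImage M (intLattice n : Set (Rn n))).indicator c α‖ₑ =
      (matImage M (intLattice n : Set (Rn n))).indicator (fun α => ‖c α‖ₑ) α := fun α =>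
    enorm_indicator_eq_indicator_enorm c α
  rw [tsum_congr h1, matImage_intLattice, ← tsum_subtype]
  exact tsum_range (fun α => ‖c α‖ₑ) ((injective_toEuclideanLin hM).comp injective_intVec)

/-- At each scale, the absolute sum of the autocorrelations is bounded by the energy of `g` in a
dilated annulus plus the sum `W` of the series itself. The second term serves at large scales, where
the series has the single nonnegative term at the origin; the first one serves at small scales,
where the growth of the number of lattice points offsets the Jacobian of the dilation. -/
theorem exists_tsum_enorm_autocorr_le {B : Matrix (Fin n) (Fin n) ℝ} (hB : B.det ≠ 0)
    (hlim : Tendsto (fun k : ℕ => zpowNorm B (-(k : ℤ))) atTop (𝓝 0)) {φ : Rn n → ℂ} {r R C : ℝ}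
    (hφ : IsAnnular φ r R C) :
    ∃ K : ℝ≥0∞, K ≠ ⊤ ∧ ∀ (g : Rn n → ℂ), MemLp g 2 volume → ∀ (j : ℤ) (W : ℂ),
      HasSum ((matImage (B ^ j) (intLattice n : Set (Rn n))).indicator
        (autocorr (scaledProduct B j φ g))) W →
      ∑' α, ‖(matImage (B ^ j) (intLattice n : Set (Rn n))).indicator
        (autocorr (scaledProduct B j φ g)) α‖ₑ ≤ K * annulusEnergy B r R g j + ‖W‖ₑ := by
  -- Beyond the scale `J`, the only point of `Bʲ ℤⁿ` of norm at most `2R` is the origin.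
  obtain ⟨J, hJ⟩ : ∃ J : ℕ, ∀ k : ℕ, J ≤ k → zpowNorm B (-(k : ℤ)) * (2 * R) < 1 := by
    have h : Tendsto (fun k : ℕ => zpowNorm B (-(k : ℤ)) * (2 * R)) atTop (𝓝 0) := by
      simpa using hlim.mul_const (2 * R)
    exact eventually_atTop.1 (h.eventually_lt_const one_pos)
  obtain ⟨C₁, hC₁⟩ := hlim.bddAbove_range
  -- Below the scale `J`, the powers of `B` are uniformly bounded.
  obtain ⟨C₀, hC₀, hC₀'⟩ : ∃ C₀ : ℝ, 0 < C₀ ∧ ∀ j : ℤ, j < J → zpowNorm B j ≤ C₀ := by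
    have hC₁0 : 0 ≤ C₁ := (zpowNorm_nonneg B _).trans (hC₁ ⟨0, rfl⟩)
    refine ⟨zpowNorm B J * C₁ + 1, by have := zpowNorm_nonneg B J; positivity, fun j hj => ?_⟩
    obtain ⟨k, hk⟩ := Int.eq_ofNat_of_zero_le (show 0 ≤ (J : ℤ) - j by omega)
    refine le_add_of_le_of_nonneg (ContinuousLinearMap.opNorm_le_bound _
      (mul_nonneg (zpowNorm_nonneg _ _) hC₁0) fun x => ?_) zero_le_one
    rw [LinearMap.coe_toContinuousLinearMap', show j = (J : ℤ) + -(k : ℤ) by omega,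
      zpow_add_apply hB, mul_assoc]
    refine (norm_zpow_apply_le B _ _).trans
      (mul_le_mul_of_nonneg_left ?_ (zpowNorm_nonneg _ _))
    exact (norm_zpow_apply_le B _ _).trans
      (mul_le_mul_of_nonneg_right (hC₁ ⟨k, rfl⟩) (norm_nonneg _))
  set v := volume (Metric.ball (0 : Rn n) (1 / 2))
  set V := volume (Metric.ball (0 : Rn n) (2 * R + C₀))
  have hv0 : v ≠ 0 := (Metric.measure_ball_pos volume _ (by norm_num)).ne'
  have hv : v ≠ ⊤ := measure_ball_lt_top.ne
  have hV : V ≠ ⊤ := measure_ball_lt_top.ne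
  refine ⟨V / v * (2 * ENNReal.ofReal C ^ 2), ENNReal.mul_ne_top (ENNReal.div_ne_top hV hv0)
    (by finiteness), fun g hg j W hW => ?_⟩
  have hdet := det_zpow_ne_zero hB j
  set h := scaledProduct B j φ g with hh
  have hzero : ∀ α, 2 * R < ‖α‖ → autocorr h α = 0 := fun α hα =>
    autocorr_eq_zero (fun x hx => scaledProduct_eq_zero hφ hx) hα
  rcases lt_or_ge j (J : ℤ) with hj | hj
  · refine le_add_of_le_of_nonneg ?_ zero_le
    rw [tsum_enorm_indicator_matImage hdet]
    set S := ∑' k : Fin n → ℤ, {k | ‖Matrix.toEuclideanLin (B ^ j) (intVec k)‖ ≤ 2 * R}.indicator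
        (fun _ => (1 : ℝ≥0∞)) k
    set I := ∫⁻ ξ, ‖h ξ‖ₑ ^ 2
    have hS : S ≤ ENNReal.ofReal |(B ^ j).det|⁻¹ * V / v :=
      (ENNReal.le_div_iff_mul_le (.inl hv0) (.inl hv)).2 (tsum_indicator_mul_le hB hC₀ (hC₀' j hj))
    have hI : I ≤ ENNReal.ofReal C ^ 2 *
        (ENNReal.ofReal |(B ^ j).det| * annulusEnergy B r R g j) :=
      lintegral_scaledProduct_le hB j hφ g
    have hd : ENNReal.ofReal |(B ^ j).det|⁻¹ * ENNReal.ofReal |(B ^ j).det| = 1 := by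
      rw [← ENNReal.ofReal_mul (by positivity), inv_mul_cancel₀ (abs_pos.2 hdet).ne',
        ENNReal.ofReal_one]
    calc ∑' k : Fin n → ℤ, ‖autocorr h (Matrix.toEuclideanLin (B ^ j) (intVec k))‖ₑ
        ≤ ∑' k : Fin n → ℤ,
          {k | ‖Matrix.toEuclideanLin (B ^ j) (intVec k)‖ ≤ 2 * R}.indicator
            (fun _ => (1 : ℝ≥0∞)) k * (2 * I) := by
          refine ENNReal.tsum_le_tsum fun k => ?_
          by_cases hk : ‖Matrix.toEuclideanLin (B ^ j) (intVec k)‖ ≤ 2 * R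
          · rw [indicator_of_mem (by exact hk), one_mul]
            exact enorm_autocorr_le
              (memLp_scaledProduct hB j hφ hg).aestronglyMeasurable.aemeasurable _
          · rw [hzero _ (not_le.1 hk), enorm_zero]
            exact zero_le
      _ = S * (2 * I) := ENNReal.tsum_mul_right
      _ ≤ (ENNReal.ofReal |(B ^ j).det|⁻¹ * V / v) * (2 * (ENNReal.ofReal C ^ 2 *
        (ENNReal.ofReal |(B ^ j).det| * annulusEnergy B r R g j))) := by gcongr
      _ = (ENNReal.ofReal |(B ^ j).det|⁻¹ * ENNReal.ofReal |(B ^ j).det|) *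
          (V / v * (2 * ENNReal.ofReal C ^ 2) * annulusEnergy B r R g j) := by
        rw [mul_div_assoc]
        ring
      _ = _ := by rw [hd, one_mul]
  · refine le_add_of_nonneg_of_le zero_le ?_
    have h0 : ∀ α ≠ 0, (matImage (B ^ j) (intLattice n : Set (Rn n))).indicator
        (autocorr h) α = 0 := by
      intro α hα
      refine indicator_apply_eq_zero.2 fun hmem => hzero α ?_
      rw [matImage_intLattice] at hmem
      obtain ⟨k, rfl⟩ := hmem
      have hk : k ≠ 0 := by
        rintro rfl
        exact hα (by simp only [intVec_zero, map_zero])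
      by_contra! hle
      obtain ⟨m, rfl⟩ := Int.eq_ofNat_of_zero_le ((Int.natCast_nonneg J).trans hj)
      have h1 := norm_zpow_apply_le B (-(m : ℤ))
        (Matrix.toEuclideanLin (B ^ (m : ℤ)) (intVec k))
      rw [zpow_neg_apply_zpow_apply hB] at h1
      have h2 := mul_le_mul_of_nonneg_left hle (zpowNorm_nonneg B (-(m : ℤ)))
      have h3 := hJ m (by exact_mod_cast hj)
      have h4 := one_le_norm_intVec hk
      linarith
    have hW' := hW.unique (hasSum_single 0 h0)
    rw [tsum_eq_single 0 fun α hα => by rw [h0 α hα, enorm_zero], hW']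

theorem summable_of_tsum_enorm_ne_top {ι : Type*} {f : ι → ℂ} (h : ∑' i, ‖f i‖ₑ ≠ ⊤) :
    Summable f :=
  Summable.of_nnnorm (ENNReal.tsum_coe_ne_top_iff_summable.1 h)

/-- The autocorrelation series is absolutely summable jointly over scales, generators and
frequencies. -/
theorem summable_indicator_autocorr {L : ℕ} {B : Matrix (Fin n) (Fin n) ℝ} (hB : B.det ≠ 0)
    (hlim : Tendsto (fun k : ℕ => zpowNorm B (-(k : ℤ))) atTop (𝓝 0)) {φ : Rn n → ℂ} {r R C : ℝ}
    (hr : 0 < r) (hφ : IsAnnular φ r R C) {g : Fin L → Rn n → ℂ}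
    (hg : ∀ l, MemLp (g l) 2 volume) {W : ℤ × Fin L → ℝ} (hW : Summable W)
    (hsum : ∀ p : ℤ × Fin L, HasSum ((matImage (B ^ p.1) (intLattice n : Set (Rn n))).indicator
      (autocorr (scaledProduct B p.1 φ (g p.2)))) (W p : ℂ)) :
    Summable fun q : (ℤ × Fin L) × Rn n =>
      (matImage (B ^ q.1.1) (intLattice n : Set (Rn n))).indicator
        (autocorr (scaledProduct B q.1.1 φ (g q.1.2))) q.2 := by
  obtain ⟨K, hK, hle⟩ := exists_tsum_enorm_autocorr_le hB hlim hφ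
  refine summable_of_tsum_enorm_ne_top ?_
  rw [ENNReal.tsum_prod']
  refine ne_top_of_le_ne_top ?_ (ENNReal.tsum_le_tsum fun p =>
    hle (g p.2) (hg p.2) p.1 (W p) (hsum p))
  rw [ENNReal.tsum_add]
  refine ENNReal.add_ne_top.2 ⟨?_, ?_⟩
  · rw [ENNReal.tsum_mul_left]
    refine ENNReal.mul_ne_top hK ?_
    rw [ENNReal.tsum_prod', ENNReal.tsum_comm, tsum_fintype]
    exact ENNReal.sum_ne_top.2 fun l _ => (tsum_annulusEnergy_lt_top hB hlim hr (hg l)).ne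
  · have h1 : Summable fun p => ‖W p‖₊ :=
      NNReal.summable_coe.1 (by simpa only [coe_nnnorm] using hW.norm)
    have h2 : ∀ p, ‖(W p : ℂ)‖ₑ = (‖W p‖₊ : ℝ≥0∞) := fun p => by
      rw [enorm_eq_nnnorm, Complex.nnnorm_real]
    rw [tsum_congr h2]
    exact ENNReal.tsum_coe_ne_top_iff_summable.2 h1

end Summability

/-! ### Density of functions with annular Fourier transform -/

section Density

variable {n : ℕ}

/-- Parseval's identity extends from a dense set to the whole space. -/
theorem hasSum_sq_inner_of_dense {ι H : Type*} [NormedAddCommGroup H] [InnerProductSpace ℂ H]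
    {f : ι → H} {S : Set H} (hS : Dense S)
    (h : ∀ x ∈ S, HasSum (fun i => ‖inner ℂ x (f i)‖ ^ 2) (‖x‖ ^ 2)) (x : H) :
    HasSum (fun i => ‖inner ℂ x (f i)‖ ^ 2) (‖x‖ ^ 2) := by
  have bessel : ∀ (F : Finset ι) (x : H), ∑ i ∈ F, ‖inner ℂ x (f i)‖ ^ 2 ≤ ‖x‖ ^ 2 := by
    intro F x
    have hcl : IsClosed {x : H | ∑ i ∈ F, ‖inner ℂ x (f i)‖ ^ 2 ≤ ‖x‖ ^ 2} :=
      isClosed_le (by fun_prop) (by fun_prop)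
    exact closure_minimal (fun y hy => sum_le_hasSum F (fun _ _ => by positivity) (h y hy)) hcl
      (hS x)
  have hsum : ∀ x, Summable fun i => ‖inner ℂ x (f i)‖ ^ 2 := fun x =>
    summable_of_sum_le (fun _ => by positivity) fun F => bessel F x
  have hle : ∀ x, ∑' i, ‖inner ℂ x (f i)‖ ^ 2 ≤ ‖x‖ ^ 2 := fun x =>
    (hsum x).tsum_le_of_sum_le fun F => bessel F x
  have hge : ∀ ε : ℝ, 0 < ε → ‖x‖ ^ 2 ≤ (1 + ε) * ∑' i, ‖inner ℂ x (f i)‖ ^ 2 := by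
    intro ε hε
    have hcl : IsClosed {y : H | ‖y‖ ^ 2 ≤
        (1 + ε) * (∑' i, ‖inner ℂ x (f i)‖ ^ 2) + (1 + ε⁻¹) * ‖y - x‖ ^ 2} :=
      isClosed_le (by fun_prop) (by fun_prop)
    -- Compare `x` with a nearby `y` in `S` by the inequality `(a + b)² ≤ (1 + ε)a² + (1 + ε⁻¹)b²`.
    have hmem := closure_minimal (fun y hy => ?_) hcl (hS x)
    · simpa using hmem
    · have hpt : ∀ i, ‖inner ℂ y (f i)‖ ^ 2 ≤
          (1 + ε) * ‖inner ℂ x (f i)‖ ^ 2 + (1 + ε⁻¹) * ‖inner ℂ (y - x) (f i)‖ ^ 2 := by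
        intro i
        set a := ‖inner ℂ x (f i)‖
        set b := ‖inner ℂ (y - x) (f i)‖
        have h1 : ‖inner ℂ y (f i)‖ ≤ a + b := by
          have e : inner ℂ y (f i) = inner ℂ x (f i) + inner ℂ (y - x) (f i) := by
            rw [← inner_add_left, add_sub_cancel]
          rw [e]
          exact norm_add_le _ _
        have h2 : 2 * a * b ≤ ε * a ^ 2 + ε⁻¹ * b ^ 2 := by
          have h3 : ε * a ^ 2 + ε⁻¹ * b ^ 2 - 2 * a * b = ε⁻¹ * (ε * a - b) ^ 2 := by
            field_simp
            ring
          have h4 : 0 ≤ ε⁻¹ * (ε * a - b) ^ 2 := by positivity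
          linarith
        have h5 : ‖inner ℂ y (f i)‖ ^ 2 ≤ (a + b) ^ 2 := by gcongr
        nlinarith
      have h6 := hasSum_le hpt (h y hy)
        (((hsum x).hasSum.mul_left (1 + ε)).add ((hsum (y - x)).hasSum.mul_left (1 + ε⁻¹)))
      refine h6.trans (add_le_add_right ?_ _)
      exact mul_le_mul_of_nonneg_left (hle _) (by positivity)
  have heq : ∑' i, ‖inner ℂ x (f i)‖ ^ 2 = ‖x‖ ^ 2 := by
    refine le_antisymm (hle x) ?_
    have hlim : Tendsto (fun ε : ℝ => (1 + ε) * ∑' i, ‖inner ℂ x (f i)‖ ^ 2) (𝓝[>] 0)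
        (𝓝 ((1 + 0) * ∑' i, ‖inner ℂ x (f i)‖ ^ 2)) :=
      Tendsto.mono_left (Continuous.tendsto (by fun_prop) 0) nhdsWithin_le_nhds
    rw [add_zero, one_mul] at hlim
    exact ge_of_tendsto hlim (eventually_nhdsWithin_of_forall fun ε hε => hge ε hε)
  exact heq ▸ (hsum x).hasSum

/-- In positive dimension, the functions whose Fourier transform is bounded and supported in an
annulus are dense in `L²`. -/
theorem dense_isAnnular [NeZero n] : Dense {f : L2 n | ∃ (φ : Rn n → ℂ) (r R C : ℝ), 0 < r ∧
    IsAnnular φ r R C ∧ (𝓕 f : L2 n) =ᵐ[volume] φ} := by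
  intro f
  set u : L2 n := 𝓕 f with hu
  have hum : Measurable u := (Lp.stronglyMeasurable u).measurable
  let S : ℕ → Set (Rn n) := fun k => annulus n (1 / (k + 1)) (k + 1) ∩ {x | ‖u x‖ ≤ k + 1}
  have hS : ∀ k, MeasurableSet (S k) := fun k =>
    (measurableSet_annulus _ _).inter (measurableSet_le hum.norm measurable_const)
  let φ : ℕ → Rn n → ℂ := fun k => (S k).indicator u
  have hφ : ∀ k : ℕ, IsAnnular (φ k) (1 / (k + 1)) (k + 1) (k + 1) := fun k =>
    { measurable := hum.indicator (hS k)
      norm_le := fun x => by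
        by_cases hx : x ∈ S k
        · simp only [φ, indicator_of_mem hx]
          exact hx.2
        · simp only [φ, indicator_of_notMem hx, norm_zero]
          positivity
      le_norm := fun x hx => (mem_of_indicator_ne_zero hx).1.1
      norm_le_of_ne_zero := fun x hx => (mem_of_indicator_ne_zero hx).1.2 }
  let fk : ℕ → L2 n := fun k => 𝓕⁻ ((hφ k).memLp.toLp : L2 n)
  have hfk : ∀ k, (𝓕 (fk k) : L2 n) = (hφ k).memLp.toLp := fun k => by
    simp only [fk, FourierInvPair.fourier_fourierInv_eq]
  have hfk' : ∀ k, (𝓕 (fk k) : L2 n) =ᵐ[volume] φ k := fun k => by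
    rw [hfk]
    exact (hφ k).memLp.coeFn_toLp
  refine mem_closure_of_tendsto (f := fk) (b := atTop) ?_ (.of_forall fun k =>
    ⟨φ k, _, _, _, by positivity, hφ k, hfk' k⟩)
  have hnorm : ∀ k, ‖fk k - f‖ ^ 2 = ∫ x, ‖φ k x - u x‖ ^ 2 := by
    intro k
    rw [← Lp.norm_fourier_eq, show 𝓕 (fk k - f) = 𝓕 (fk k) - 𝓕 f from
      (Lp.fourierTransformₗᵢ (Rn n) ℂ).map_sub _ _, norm_sq_eq_integral]
    refine integral_congr_ae ?_
    filter_upwards [Lp.coeFn_sub (𝓕 (fk k) : L2 n) (𝓕 f), hfk' k] with x h1 h2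
    rw [h1, Pi.sub_apply, h2]
  have hlim : Tendsto (fun k => ∫ x, ‖φ k x - u x‖ ^ 2) atTop (𝓝 (∫ _ : Rn n, (0 : ℝ))) := by
    refine tendsto_integral_of_dominated_convergence (fun x => ‖u x‖ ^ 2)
      (fun k => (((hφ k).measurable.sub hum).norm.pow_const 2).aestronglyMeasurable)
      ((memLp_two_iff_integrable_sq_norm (Lp.aestronglyMeasurable u)).1 (Lp.memLp u)) ?_ ?_
    · intro k
      refine .of_forall fun x => ?_
      rw [Real.norm_eq_abs, abs_of_nonneg (by positivity)]
      by_cases hx : x ∈ S k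
      · simp only [φ, indicator_of_mem hx, sub_self, norm_zero]
        simp
      · simp only [φ, indicator_of_notMem hx, zero_sub, norm_neg, le_refl]
    · have h0 : ∀ᵐ x : Rn n, x ≠ 0 := Measure.ae_ne volume 0
      filter_upwards [h0] with x hx
      have hx0 := norm_pos_iff.2 hx
      refine tendsto_const_nhds.congr' ?_
      obtain ⟨N, hN⟩ := exists_nat_ge (max ‖x‖⁻¹ (max ‖x‖ ‖u x‖))
      filter_upwards [eventually_ge_atTop N] with k hk
      have hk' : max ‖x‖⁻¹ (max ‖x‖ ‖u x‖) ≤ k + 1 :=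
        hN.trans ((Nat.cast_le.2 hk).trans (by linarith))
      simp only [max_le_iff] at hk'
      have hx : x ∈ S k := by
        refine ⟨⟨?_, hk'.2.1⟩, hk'.2.2⟩
        rw [one_div]
        exact inv_le_of_inv_le₀ hx0 hk'.1
      simp only [φ, indicator_of_mem hx, sub_self, norm_zero]
      norm_num
  rw [integral_zero] at hlim
  simp_rw [← hnorm] at hlim
  rw [tendsto_iff_norm_sub_tendsto_zero]
  have := hlim.sqrt
  simpa using this

end Density

/-! ### Comparison of the two lattices -/

section Oversampling

variable {n L : ℕ}

theorem waveletSystem_smul (c : ℂ) (Ψ : Fin L → L2 n) (A : GL (Fin n) ℝ)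
    (Γ : Submodule ℤ (Rn n)) (q : ℤ × Γ × Fin L) :
    waveletSystem (fun l => c • Ψ l) A Γ q = c • waveletSystem Ψ A Γ q := by
  simp only [waveletSystem, translation_smul, dilation_smul]

theorem countable_lattice {Γ : Submodule ℤ (Rn n)} {P : Matrix (Fin n) (Fin n) ℝ}
    (hΓ : (Γ : Set (Rn n)) = matImage P (intLattice n : Set (Rn n))) : Countable Γ := by
  have h : (Γ : Set (Rn n)).Countable := by
    rw [hΓ, matImage_intLattice]
    exact countable_range _
  exact h.to_subtype

/-- The autocorrelation at scale `p.1` for the generator `Ψ p.2`, restricted to the image of the set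
`S` under `Bʲ`, where `B` is the transpose of `A` and `j = p.1`. -/
noncomputable def freqTerm (A : GL (Fin n) ℝ) (Ψ : Fin L → L2 n) (S : Set (Rn n)) (φ : Rn n → ℂ)
    (p : ℤ × Fin L) : Rn n → ℂ :=
  (matImage ((A : Matrix (Fin n) (Fin n) ℝ).transpose ^ p.1) S).indicator
    (autocorr (scaledProduct (A : Matrix (Fin n) (Fin n) ℝ).transpose p.1 φ (𝓕 (Ψ p.2) : L2 n)))

theorem freqTerm_modulate (A : GL (Fin n) ℝ) (Ψ : Fin L → L2 n) (S : Set (Rn n)) (φ : Rn n → ℂ)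
    (p : ℤ × Fin L) (x α : Rn n) :
    freqTerm A Ψ S (fun ξ => (𝐞 (inner ℝ x ξ) : ℂ) * φ ξ) p α =
      (𝐞 (-inner ℝ x α) : ℂ) * freqTerm A Ψ S φ p α := by
  by_cases hα : α ∈ matImage ((A : Matrix (Fin n) (Fin n) ℝ).transpose ^ p.1) S
  · rw [freqTerm, freqTerm, indicator_of_mem hα, indicator_of_mem hα,
      autocorr_scaledProduct_modulate]
  · rw [freqTerm, freqTerm, indicator_of_notMem hα, indicator_of_notMem hα, mul_zero]

/-- The energy of `f` along the wavelet system with lattice `Γ = P ℤⁿ` is the sum of its energies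
at the single scales, up to the factor `|det P|`. -/
theorem hasSum_waveletSystem_iff {A : GL (Fin n) ℝ} {Ψ : Fin L → L2 n} {f : L2 n}
    {φ : Rn n → ℂ} {r R C : ℝ} (hφ : IsAnnular φ r R C) (hf : (𝓕 f : L2 n) =ᵐ[volume] φ)
    {Γ : Submodule ℤ (Rn n)} {P : Matrix (Fin n) (Fin n) ℝ} (hP : P.det ≠ 0)
    (hΓ : (Γ : Set (Rn n)) = matImage P (intLattice n : Set (Rn n))) {W : ℤ × Fin L → ℝ}
    (hW : ∀ p, HasSum (freqTerm A Ψ (dualLattice Γ) φ p) (W p : ℂ)) {N : ℝ} :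
    HasSum (fun q => ‖inner ℂ f (waveletSystem Ψ A Γ q)‖ ^ 2) N ↔ HasSum W (|P.det| * N) := by
  have hP0 : |P.det| ≠ 0 := (abs_pos.2 hP).ne'
  let e : (ℤ × Fin L) × Γ ≃ ℤ × Γ × Fin L :=
    (Equiv.prodAssoc ℤ (Fin L) Γ).trans (Equiv.prodCongr (Equiv.refl ℤ) (Equiv.prodComm _ _))
  let F : (ℤ × Fin L) × Γ → ℝ := fun q =>
    ‖inner ℂ f (dilation (A ^ q.1.1) (translation (q.2 : Rn n) (Ψ q.1.2)))‖ ^ 2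
  have hF : ∀ p, HasSum (fun γ => F (p, γ)) (|P.det|⁻¹ * W p) := fun p => by
    obtain ⟨W', h1, h2⟩ := hasSum_sq_inner_lattice (ψ := Ψ p.2) hφ hf hP hΓ p.1
    have : W' = W p := Complex.ofReal_injective (h2.unique (hW p))
    rwa [this] at h1
  have h1 : HasSum (fun q => ‖inner ℂ f (waveletSystem Ψ A Γ q)‖ ^ 2) N ↔ HasSum F N :=
    (e.hasSum_iff (f := fun q => ‖inner ℂ f (waveletSystem Ψ A Γ q)‖ ^ 2)).symm
  have h2 : HasSum W (|P.det| * N) ↔ HasSum (fun p => |P.det|⁻¹ * W p) N := by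
    constructor
    · intro h
      simpa [hP0] using h.mul_left |P.det|⁻¹
    · intro h
      simpa [hP0] using h.mul_left |P.det|
  rw [h1, h2]
  constructor
  · exact fun h => h.prod_fiberwise hF
  · intro h
    have hsum : Summable F := (summable_prod_of_nonneg fun q => by positivity).2
      ⟨fun p => (hF p).summable, by
        simp_rw [fun p => (hF p).tsum_eq]
        exact h.summable⟩
    have := hsum.hasSum.prod_fiberwise hF
    rw [← this.unique h]
    exact hsum.hasSum

/-- The iterated sum of a summable double family, taken in the opposite order. -/
theorem tsum_tsum_eq_of_hasSum {ι κ : Type*} {G : ι × κ → ℂ} (hG : Summable G) {W : ι → ℂ}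
    (hW : ∀ i, HasSum (fun k => G (i, k)) (W i)) {N : ℂ} (hN : HasSum W N) :
    ∑' k, ∑' i, G (i, k) = N := by
  rw [hN.unique (hG.hasSum.prod_fiberwise hW), ← (Equiv.prodComm κ ι).tsum_eq G]
  exact hG.prod_symm.tsum_prod.symm

theorem norm_sq_eq_of_fourier {f : L2 n} {φ : Rn n → ℂ} (hf : (𝓕 f : L2 n) =ᵐ[volume] φ) :
    ‖f‖ ^ 2 = ∫ ξ, ‖φ ξ‖ ^ 2 := by
  rw [← Lp.norm_fourier_eq, norm_sq_eq_integral]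
  exact integral_congr_ae (hf.mono fun x hx => by simp only [hx])

/-- If the wavelet system over `ℤⁿ` is a Parseval frame, the energies at the single scales of any
function with an annular Fourier transform add up to its squared norm. -/
theorem exists_hasSum_scale_energy {A : GL (Fin n) ℝ} {Ψ : Fin L → L2 n}
    (hΨ : IsParsevalFrame (waveletSystem Ψ A (intLattice n))) {φ : Rn n → ℂ} {r R C : ℝ}
    (hφ : IsAnnular φ r R C) :
    ∃ W : ℤ × Fin L → ℝ, (∀ p, HasSum (freqTerm A Ψ (intLattice n) φ p) (W p : ℂ)) ∧
      HasSum W (∫ ξ, ‖φ ξ‖ ^ 2) := by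
  have hone : (intLattice n : Set (Rn n)) =
      matImage (1 : Matrix (Fin n) (Fin n) ℝ) (intLattice n : Set (Rn n)) := (matImage_one _).symm
  have hdet : (1 : Matrix (Fin n) (Fin n) ℝ).det ≠ 0 := by simp
  let f : L2 n := 𝓕⁻ (hφ.memLp.toLp : L2 n)
  have hf : (𝓕 f : L2 n) =ᵐ[volume] φ := by
    simp only [f, FourierInvPair.fourier_fourierInv_eq]
    exact hφ.memLp.coeFn_toLp
  choose W h1 h2 using fun p : ℤ × Fin L =>
    hasSum_sq_inner_lattice (A := A) (ψ := Ψ p.2) hφ hf hdet hone p.1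
  have h3 := (hasSum_waveletSystem_iff hφ hf hdet hone h2).1 (hΨ.2 f)
  rw [norm_sq_eq_of_fourier hf, Matrix.det_one, abs_one, one_mul] at h3
  simp only [dualLattice_intLattice] at h2
  exact ⟨W, h2, h3⟩

/-- If the wavelet system over `ℤⁿ` is a Parseval frame, the autocorrelations at a frequency
`α` add up to `0` if `α ≠ 0` and to `‖f‖²` if `α = 0`. -/
theorem summable_freqTerm_and_tsum [NeZero n] {A : GL (Fin n) ℝ}
    (hA : IsExpansive (A : Matrix (Fin n) (Fin n) ℝ)) {Ψ : Fin L → L2 n}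
    (hΨ : IsParsevalFrame (waveletSystem Ψ A (intLattice n))) {f : L2 n} {φ : Rn n → ℂ}
    {r R C : ℝ} (hr : 0 < r) (hφ : IsAnnular φ r R C) (hf : (𝓕 f : L2 n) =ᵐ[volume] φ) :
    Summable (fun q : (ℤ × Fin L) × Rn n => freqTerm A Ψ (intLattice n) φ q.1 q.2) ∧
      (∀ α ≠ 0, ∑' p, freqTerm A Ψ (intLattice n) φ p α = 0) ∧
      ∑' p, freqTerm A Ψ (intLattice n) φ p 0 = (‖f‖ ^ 2 : ℝ) := by
  have hBdet : (A : Matrix (Fin n) (Fin n) ℝ).transpose.det ≠ 0 := by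
    simpa using det_coe_ne_zero A
  obtain ⟨W, hW1, hW2⟩ := exists_hasSum_scale_energy hΨ hφ
  have hG : Summable fun q : (ℤ × Fin L) × Rn n => freqTerm A Ψ (intLattice n) φ q.1 q.2 :=
    summable_indicator_autocorr (g := fun l => (𝓕 (Ψ l) : L2 n)) (W := W) hBdet
      (tendsto_zpowNorm_of_isExpansive A hA) hr hφ (fun l => Lp.memLp (𝓕 (Ψ l) : L2 n))
      hW2.summable hW1
  rw [← norm_sq_eq_of_fourier hf] at hW2
  -- Modulating `φ` turns the identity for `f` into a trigonometric series.
  have hseries : ∀ x, ∑' α, (𝐞 (-inner ℝ x α) : ℂ) * ∑' p, freqTerm A Ψ (intLattice n) φ p α =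
      (‖f‖ ^ 2 : ℝ) := by
    intro x
    obtain ⟨Wx, h1, h2⟩ := exists_hasSum_scale_energy hΨ (hφ.modulate x)
    have hnorm : ∫ ξ, ‖(𝐞 (inner ℝ x ξ) : ℂ) * φ ξ‖ ^ 2 = ‖f‖ ^ 2 := by
      rw [norm_sq_eq_of_fourier hf]
      simp only [norm_mul, Circle.norm_coe, one_mul]
    rw [hnorm] at h2
    have hGx : Summable fun q : (ℤ × Fin L) × Rn n =>
        (𝐞 (-inner ℝ x q.2) : ℂ) * freqTerm A Ψ (intLattice n) φ q.1 q.2 := by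
      refine Summable.of_norm ?_
      simpa only [norm_mul, Circle.norm_coe, one_mul] using hG.norm
    have h3 := tsum_tsum_eq_of_hasSum hGx (W := fun p => (Wx p : ℂ))
      (fun p => (h1 p).congr_fun fun α => (freqTerm_modulate A Ψ _ φ p x α).symm)
      (Complex.hasSum_ofReal.2 h2)
    simpa only [tsum_mul_left] using h3
  have hC : Summable fun α => ∑' p, freqTerm A Ψ (intLattice n) φ p α := hG.prod_symm.prod
  have hzero : ∀ α ≠ 0, ∑' p, freqTerm A Ψ (intLattice n) φ p α = 0 := fun α hα =>
    eq_zero_of_tsum_fourierChar_eq hC hseries hα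
  refine ⟨hG, hzero, ?_⟩
  have h0 := hseries 0
  rw [tsum_eq_single 0 fun α hα => by rw [hzero α hα, mul_zero]] at h0
  simpa using h0

/-- The oversampled system is tight on functions with annular Fourier transform: a frequency occurs
for `Λ` at the same scales as for `ℤⁿ`, or at no scale, in which case it is not `0`. -/
theorem hasSum_oversampled [NeZero n] {A : GL (Fin n) ℝ}
    (hA : IsExpansive (A : Matrix (Fin n) (Fin n) ℝ)) {Ψ : Fin L → L2 n}
    {Λ : Submodule ℤ (Rn n)} (hΛ : intLattice n ≤ Λ) {P : Matrix (Fin n) (Fin n) ℝ}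
    (hP : P.det ≠ 0) (hΛP : (Λ : Set (Rn n)) = matImage P (intLattice n : Set (Rn n)))
    (hdual : ∀ j : ℤ,
      matImage ((A : Matrix (Fin n) (Fin n) ℝ).transpose ^ j) (intLattice n : Set (Rn n)) ∩
          (dualLattice Λ : Set (Rn n)) ⊆
        matImage ((A : Matrix (Fin n) (Fin n) ℝ).transpose ^ j) (dualLattice Λ : Set (Rn n)))
    (hΨ : IsParsevalFrame (waveletSystem Ψ A (intLattice n))) {f : L2 n} {φ : Rn n → ℂ}
    {r R C : ℝ} (hr : 0 < r) (hφ : IsAnnular φ r R C) (hf : (𝓕 f : L2 n) =ᵐ[volume] φ) :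
    HasSum (fun q => ‖inner ℂ f (waveletSystem Ψ A Λ q)‖ ^ 2) (|P.det|⁻¹ * ‖f‖ ^ 2) := by
  obtain ⟨hG, hzero, hone⟩ := summable_freqTerm_and_tsum hA hΨ hr hφ hf
  choose W h1 h2 using fun p : ℤ × Fin L =>
    hasSum_sq_inner_lattice (A := A) (ψ := Ψ p.2) hφ hf hP hΛP p.1
  have hdet := det_coe_ne_zero A
  rw [hasSum_waveletSystem_iff hφ hf hP hΛP h2, mul_inv_cancel_left₀ (abs_pos.2 hP).ne']
  set B := (A : Matrix (Fin n) (Fin n) ℝ).transpose with hB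
  have hBdet : B.det ≠ 0 := by simpa [hB] using hdet
  let D : ℤ → Set (Rn n) := fun j => matImage (B ^ j) (intLattice n : Set (Rn n))
  let D' : ℤ → Set (Rn n) := fun j => matImage (B ^ j) (dualLattice Λ : Set (Rn n))
  have hsub : ∀ j, D' j ⊆ D j := fun j => image_mono (by
    have := dualLattice_anti hΛ
    rwa [dualLattice_intLattice] at this)
  have hmat : ∀ (i j : ℤ) (S : Set (Rn n)),
      matImage (B ^ i) (matImage (B ^ j) S) = matImage (B ^ (i + j)) S := fun i j S => by
    rw [matImage_matImage, Matrix.zpow_add hBdet.isUnit]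
  -- Rescaling the hypothesis: a frequency occurring for `Λ` occurs at the same scales for `ℤⁿ`.
  have hmem : ∀ {α : Rn n} {i : ℤ}, α ∈ D' i → ∀ j, α ∈ D j → α ∈ D' j := by
    rintro _ i ⟨η, hη, rfl⟩ j hj
    have hη' : η ∈ matImage (B ^ (j - i)) (intLattice n : Set (Rn n)) := by
      have := mem_image_of_mem (fun x => Matrix.toEuclideanLin (B ^ (-i)) x) hj
      simp only [zpow_neg_apply_zpow_apply hBdet] at this
      change η ∈ matImage (B ^ (-i)) (matImage (B ^ j) _) at this
      rwa [hmat, neg_add_eq_sub] at this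
    have := mem_image_of_mem (fun x => Matrix.toEuclideanLin (B ^ i) x) (hdual (j - i) ⟨hη', hη⟩)
    change _ ∈ matImage (B ^ i) (matImage (B ^ (j - i)) _) at this
    rwa [hmat, add_sub_cancel] at this
  have hG' : Summable fun q : (ℤ × Fin L) × Rn n => freqTerm A Ψ (dualLattice Λ) φ q.1 q.2 := by
    refine (hG.indicator {q | q.2 ∈ D' q.1.1}).congr fun q => ?_
    by_cases hq : q.2 ∈ D' q.1.1
    · rw [indicator_of_mem (by exact hq), freqTerm, freqTerm, indicator_of_mem hq,
        indicator_of_mem (hsub _ hq)]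
    · rw [indicator_of_notMem (by exact hq), freqTerm, indicator_of_notMem hq]
  have heq : ∀ α, (∃ i, α ∈ D' i) → ∀ p,
      freqTerm A Ψ (dualLattice Λ) φ p α = freqTerm A Ψ (intLattice n) φ p α := by
    rintro α ⟨i, hi⟩ p
    by_cases hp : α ∈ D p.1
    · rw [freqTerm, freqTerm, indicator_of_mem hp, indicator_of_mem (hmem hi _ hp)]
    · rw [freqTerm, freqTerm, indicator_of_notMem hp, indicator_of_notMem fun h => hp (hsub _ h)]
  have hzero' : ∀ α ≠ 0, ∑' p, freqTerm A Ψ (dualLattice Λ) φ p α = 0 := by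
    intro α hα
    by_cases h : ∃ i, α ∈ D' i
    · rw [tsum_congr (heq α h)]
      exact hzero α hα
    · push Not at h
      have : ∀ p, freqTerm A Ψ (dualLattice Λ) φ p α = 0 := fun p => indicator_of_notMem (h p.1) _
      rw [tsum_congr this, tsum_zero]
  have hone' : ∑' p, freqTerm A Ψ (dualLattice Λ) φ p 0 = (‖f‖ ^ 2 : ℝ) := by
    rw [tsum_congr (heq 0 ⟨0, 0, (dualLattice Λ).zero_mem, map_zero _⟩)]
    exact hone
  have hWs : HasSum (fun p => (W p : ℂ)) _ := hG'.hasSum.prod_fiberwise h2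
  have htot := tsum_tsum_eq_of_hasSum hG' h2 hWs
  rw [tsum_eq_single 0 hzero', hone'] at htot
  rw [← htot] at hWs
  exact Complex.hasSum_ofReal.1 hWs

end Oversampling

end WaveletOversampling

theorem theorem4p2 {n L : ℕ} (A : GL (Fin n) ℝ)
    (hA : IsExpansive (A : Matrix (Fin n) (Fin n) ℝ))
    (Ψ : Fin L → L2 n)
    (Λ : Submodule ℤ (Rn n)) [DiscreteTopology Λ] (hΛ : intLattice n ≤ Λ)
    (hdual : ∀ j : ℤ,
      matImage ((A : Matrix (Fin n) (Fin n) ℝ).transpose ^ j) (intLattice n : Set (Rn n)) ∩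
          (dualLattice Λ : Set (Rn n)) ⊆
        matImage ((A : Matrix (Fin n) (Fin n) ℝ).transpose ^ j) (dualLattice Λ : Set (Rn n)))
    (hΨ : IsParsevalFrame (waveletSystem Ψ A (intLattice n))) :
    IsParsevalFrame
      (waveletSystem (fun l => (Real.sqrt (ZLattice.covolume Λ) : ℂ) • Ψ l) A Λ) := by
  have := isZLattice_of_intLattice_le hΛ
  obtain ⟨P, hP, hcov, hΛP⟩ := exists_matrix_of_isZLattice Λ
  have := countable_lattice hΛP
  refine ⟨inferInstance, ?_⟩
  have hterm : ∀ (f : L2 n) q, ‖inner ℂ f (waveletSystem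
      (fun l => (Real.sqrt (ZLattice.covolume Λ) : ℂ) • Ψ l) A Λ q)‖ ^ 2 =
        |P.det| * ‖inner ℂ f (waveletSystem Ψ A Λ q)‖ ^ 2 := fun f q => by
    rw [waveletSystem_smul, inner_smul_right, norm_mul, mul_pow, Complex.norm_real,
      Real.norm_eq_abs, sq_abs, ← hcov, Real.sq_sqrt (abs_nonneg _)]
  have hP0 : |P.det| ≠ 0 := (abs_pos.2 hP).ne'
  simp only [hterm]
  rcases Nat.eq_zero_or_pos n with rfl | hn
  · -- On the one-point space `ℝ⁰` the two lattices coincide.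
    have hΛ0 : Λ = intLattice 0 := by
      ext x
      rw [Subsingleton.elim x 0]
      exact ⟨fun _ => (intLattice 0).zero_mem, fun _ => Λ.zero_mem⟩
    subst hΛ0
    simpa using hΨ.2
  · have : NeZero n := ⟨hn.ne'⟩
    have hsys := hasSum_sq_inner_of_dense (dense_isAnnular (n := n))
      (f := waveletSystem (fun l => (Real.sqrt (ZLattice.covolume Λ) : ℂ) • Ψ l) A Λ) ?_
    · simpa only [hterm] using hsys
    · rintro f ⟨φ, r, R, C, hr, hφ, hf⟩
      simp only [hterm]
      simpa [hP0] using
        (hasSum_oversampled hA hΛ hP hΛP hdual hΨ hr hφ hf).mul_left |P.det|
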